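/- Setting. Let $K\ge 1$, $\theta\in\mathbb R$, and for each arm $a\in\mathcal A=\{1,\dots,K\}$ let $\nu_a$ be a $1$-sub-Gaussian probability distribution on $\mathbb R$ with mean $\mu_a\ne\theta$, i.e. $\mathbb E_{X\sim\nu_a}[e^{\lambda(X-\mu_a)}]\le e^{\lambda^2/2}$ for all $\lambda\in\mathbb R$. In round $t\ge1$ an arm $a_t$ is pulled, chosen from the past history (and possibly internal randomization), and an observation $X_t$ is received whose conditional law given the past and $a_t$ is $\nu_{a_t}$. Put $N_a(t)=\sum_{s\le t}\mathbf 1\{a_s=a\}$, $\hat\mu_a(t)=N_a(t)^{-1}\sum_{s\le t}\mathbf 1\{a_s=a\}X_s$, $W_a^{+}(t)=\sqrt{N_a(t)}\,(\hat\mu_a(t)-\theta)_+$ and $W_a^{-}(t)=\sqrt{N_a(t)}\,(\theta-\hat\mu_a(t))_+$. The APGAI algorithm with $n_0\ge1$ initial pulls per arm first pulls each arm $n_0$ times (rounds $1,\dots,n_0K$). Then, for every $t\ge n_0K$: if $\max_a\hat\mu_a(t)\le\theta$, it recommends $\hat a_t=\emptyset$ and pulls $a_{t+1}\in\arg\min_a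 W_a^-(t)$; otherwise it recommends $\hat a_t=a_{t+1}$ and pulls $a_{t+1}\in\arg\max_a W_a^+(t)$. Ties are broken arbitrarily, possibly at random. Let $\mathcal A_\theta=\{a:\mu_a\ge\theta\}$ be the set of good arms and $H_1(\mu)=\sum_a|\mu_a-\theta|^{-2}$. Let $\overline W_{-1}(x)=-W_{-1}(-e^{-x})$ for $x\ge1$, where $W_{-1}$ is the negative branch of the Lambert function, and $$h_2(\log(1/\delta),A,B)=A\,\overline W_{-1}\!\left(\log(1/\delta)+\tfrac BA+\log A\right),$$ $$U_\delta(\mu)=\begin{cases}h_2(\log(1/\delta),\,18H_1(\mu),\,n_0K)&\text{if }\mathcal A_\theta=\emptyset,\\ h_2(\log(1/\delta),\,4H_1(\mu),\,n_0K+2|\mathcal A_\theta|)&\text{otherwise.}\end{cases}$$ Theorem. For every $\delta\in(0,1)$: - if $\mathcal A_\theta=\emptyset$, then $\mathbb P(\forall t>U_\delta(\mu):\ \hat a_t=\emptyset)\ge1-\delta$; - if $\mathcal A_\theta\neq\emptyset$, then $\mathbb P(\forall t>U_\delta(\mu):\ \hat a_t\in\mathcal A_\theta)\ge1-\delta$.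 Moreover, for all fixed $A>0$ and $B\in\mathbb R$, $h_2(\log(1/\delta),A,B)=A\log(1/\delta)+O(\log\log(1/\delta))$ as $\delta\to0$. In particular $U_\delta(\mu)=2\alpha H_1(\mu)\log(1/\delta)+O(\log\log(1/\delta))$ as $\delta\to0$, with $\alpha=9$ if $\mathcal A_\theta=\emptyset$ and $\alpha=2$ otherwise. -/

import Mathlib

open Filter Topology MeasureTheory ProbabilityTheory

noncomputable section

namespace GoodArm

/-! ### Lambert function -/

/-- The negative branch `W₋₁` of the Lambert function: for `y ∈ [-e⁻¹, 0)` it is the unique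
real number `w ≤ -1` with `w * exp w = y` (see `lambertWNeg_spec`). -/
def lambertWNeg (y : ℝ) : ℝ := sInf {w : ℝ | w ≤ -1 ∧ w * Real.exp w = y}

/-- `W̄₋₁(x) = -W₋₁(-e⁻ˣ)`, meaningful for `x ≥ 1`. -/
def lambertBar (x : ℝ) : ℝ := -lambertWNeg (-Real.exp (-x))

/-- `h₂(ℓ, A, B) = A * W̄₋₁(ℓ + B / A + log A)`. -/
def h₂ (ℓ A B : ℝ) : ℝ := A * lambertBar (ℓ + B / A + Real.log A)

/-! ### Bandit instance -/

/-- The set of good arms: those with mean at least the threshold `θ`. -/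
def goodArms {K : ℕ} (θ : ℝ) (μ : Fin K → ℝ) : Finset (Fin K) :=
  Finset.univ.filter fun a => θ ≤ μ a

/-- `H₁(μ) = ∑ₐ Δₐ⁻²` with `Δₐ = |μₐ - θ|`. -/
def H₁ {K : ℕ} (θ : ℝ) (μ : Fin K → ℝ) : ℝ := ∑ a, (|μ a - θ| ^ 2)⁻¹

/-- The deterministic time `U_δ(μ)`; each arm is pulled `n₀` times as initialization. -/
def unverifiableTime {K : ℕ} (n₀ : ℕ) (θ : ℝ) (μ : Fin K → ℝ) (δ : ℝ) : ℝ :=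
  if goodArms θ μ = ∅ then
    h₂ (Real.log (1 / δ)) (18 * H₁ θ μ) (n₀ * K)
  else
    h₂ (Real.log (1 / δ)) (4 * H₁ θ μ) (n₀ * K + 2 * (goodArms θ μ).card)

/-- `ν₀` is a `1`-sub-Gaussian probability distribution on `ℝ` with mean `μ₀`. -/
structure IsOneSubGaussian (ν₀ : Measure ℝ) (μ₀ : ℝ) : Prop where
  isProbabilityMeasure : IsProbabilityMeasure ν₀
  integrable : Integrable (fun x => x) ν₀
  mean_eq : ∫ x, x ∂ν₀ = μ₀
  subgaussian : HasSubgaussianMGF (fun x => x - μ₀) 1 ν₀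

/-- Interaction with the bandit `ν`. Rounds are numbered `1, 2, …`; `arm t` is the arm pulled in
round `t` and `reward t` the observation received (the values at `t = 0` are irrelevant).
`ℱ t` contains the history up to the end of round `t` and possibly the internal randomization
used to choose the arm of round `t + 1`. Given `ℱ t`, the next observation has distribution
`ν (arm (t + 1))`. -/
structure IsBanditProcess {Ω : Type*} {mΩ : MeasurableSpace Ω} {K : ℕ} (P : Measure Ω)
    (ν : Fin K → Measure ℝ) (ℱ : Filtration ℕ mΩ)
    (arm : ℕ → Ω → Fin K) (reward : ℕ → Ω → ℝ) : Prop where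
  measurable_arm : ∀ t, Measurable[ℱ t] (arm (t + 1))
  measurable_reward : ∀ t, Measurable[ℱ (t + 1)] (reward (t + 1))
  condLaw : ∀ t, ∀ s : Set ℝ, MeasurableSet s →
    P⟦reward (t + 1) ⁻¹' s | ℱ t⟧ =ᵐ[P] fun ω => (ν (arm (t + 1) ω)).real s

/-! ### The APGAI algorithm

In this part `arm : ℕ → Fin K` and `reward : ℕ → ℝ` are the arms and observations along one
trajectory. -/

/-- `N_a(t)`: number of pulls of arm `a` in rounds `1, …, t`. -/
def numPulls {K : ℕ} (arm : ℕ → Fin K) (a : Fin K) (t : ℕ) : ℕ :=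
  ((Finset.Icc 1 t).filter fun s => arm s = a).card

/-- Empirical mean of arm `a` after round `t`. -/
def empMean {K : ℕ} (arm : ℕ → Fin K) (reward : ℕ → ℝ) (a : Fin K) (t : ℕ) : ℝ :=
  (∑ s ∈ (Finset.Icc 1 t).filter (fun s => arm s = a), reward s) / numPulls arm a t

/-- `W⁺_a(t) = √N_a(t) * (empirical mean - θ)₊`. -/
def Wpos {K : ℕ} (θ : ℝ) (arm : ℕ → Fin K) (reward : ℕ → ℝ) (a : Fin K) (t : ℕ) : ℝ :=
  √(numPulls arm a t : ℝ) * max (empMean arm reward a t - θ) 0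

/-- `W⁻_a(t) = √N_a(t) * (θ - empirical mean)₊`. -/
def Wneg {K : ℕ} (θ : ℝ) (arm : ℕ → Fin K) (reward : ℕ → ℝ) (a : Fin K) (t : ℕ) : ℝ :=
  √(numPulls arm a t : ℝ) * max (-(empMean arm reward a t - θ)) 0

/-- The trajectory follows APGAI with threshold `θ` and `n₀` initial pulls of each arm:
the first `n₀ * K` rounds pull each arm `n₀` times, and for every `t ≥ n₀ * K` the arm pulled in
round `t + 1` and the answer `guess t` recommended at time `t` (`none` stands for `∅`) obey the
rule of the algorithm; ties are broken arbitrarily. -/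
def FollowsAPGAI {K : ℕ} (n₀ : ℕ) (θ : ℝ) (arm : ℕ → Fin K) (reward : ℕ → ℝ)
    (guess : ℕ → Option (Fin K)) : Prop :=
  (∀ a, numPulls arm a (n₀ * K) = n₀) ∧
  ∀ t, n₀ * K ≤ t →
    ((∀ a, empMean arm reward a t ≤ θ) →
      guess t = none ∧
        ∀ b, Wneg θ arm reward (arm (t + 1)) t ≤ Wneg θ arm reward b t) ∧
    (¬ (∀ a, empMean arm reward a t ≤ θ) →
      guess t = some (arm (t + 1)) ∧
        ∀ b, Wpos θ arm reward b t ≤ Wpos θ arm reward (arm (t + 1)) t)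

/-- The set defining `lambertWNeg y` is a singleton for `y ∈ [-e⁻¹, 0)`. -/
theorem lambertWNeg_spec {y : ℝ} (h1 : -Real.exp (-1) ≤ y) (h2 : y < 0) :
    lambertWNeg y ≤ -1 ∧ lambertWNeg y * Real.exp (lambertWNeg y) = y ∧
      ∀ w : ℝ, w ≤ -1 → w * Real.exp w = y → w = lambertWNeg y := by
  have hanti : StrictAntiOn (fun w : ℝ => w * Real.exp w) (Set.Iic (-1)) := by
    apply strictAntiOn_of_deriv_neg (convex_Iic _) (by fun_prop)
    intro w hw
    rw [interior_Iic, Set.mem_Iio] at hw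
    have : HasDerivAt (fun w : ℝ => w * Real.exp w) (1 * Real.exp w + w * Real.exp w) w :=
      (hasDerivAt_id w).mul (Real.hasDerivAt_exp w)
    rw [this.deriv]
    nlinarith [Real.exp_pos w]
  have hex : ∃ w : ℝ, w ≤ -1 ∧ w * Real.exp w = y := by
    have hlim : Tendsto (fun w : ℝ => w * Real.exp w) atBot (𝓝 0) := by
      have h := (Real.tendsto_pow_mul_exp_neg_atTop_nhds_zero 1).comp tendsto_neg_atBot_atTop
      have h' := h.neg
      simpa [Function.comp_def] using h'
    obtain ⟨M, hM, hM1⟩ := ((hlim.eventually (lt_mem_nhds h2)).and (eventually_le_atBot (-1))).exists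
    have hc : ContinuousOn (fun w : ℝ => w * Real.exp w) (Set.Icc M (-1)) := by fun_prop
    have := intermediate_value_Icc' hM1 hc
    obtain ⟨w, hw, hwy⟩ := this ⟨by simpa using h1, hM.le⟩
    exact ⟨w, hw.2, hwy⟩
  obtain ⟨w, hw, hwy⟩ := hex
  have huniq : ∀ v : ℝ, v ≤ -1 → v * Real.exp v = y → v = w := fun v hv hvy =>
    hanti.injOn hv hw (hvy.trans hwy.symm)
  have hset : {w : ℝ | w ≤ -1 ∧ w * Real.exp w = y} = {w} := by
    ext v
    exact ⟨fun h => huniq v h.1 h.2, fun h => by rw [Set.mem_singleton_iff.1 h]; exact ⟨hw, hwy⟩⟩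
  have hW : lambertWNeg y = w := by rw [lambertWNeg, hset, csInf_singleton]
  rw [hW]
  exact ⟨hw, hwy, huniq⟩

end GoodArm

end

/-! The two branches of APGAI are one rule: after the initialization, the arm pulled maximizes the
signed statistic W_a = √N_a (μ̂_a − θ), and the answer is ∅ exactly when every W_a ≤ 0
(`FollowsAPGAI.signedStat_le`, `FollowsAPGAI.guess_spec`). Deviations are controlled by a maximal
inequality for exponential supermartingales whose coefficients may depend on the arm and on its
current number of pulls (`IsBanditProcess.measure_exists_le_logWealth_le`). Write Δ_a = |μ_a − θ|.
The time U solves U = A c + B with c = log(U/δ) (`h₂_spec`), so it suffices to bound the failure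
probability by U e^{-c} = δ.

No good arm: if t > U, some arm b has more than n₀ + 18c/Δ_b² pulls. When b received one of its late
pulls, at a count fixed in advance, its statistic was the largest. Either it was unusually high for
that count, or all statistics were very negative, in which case the arm behind a wrong answer at
time t has climbed back above 0 since then (`IsBanditProcess.measure_return_le`). Both are unlikely.

Some good arm: if t > U and the answer is wrong, then the pulls beyond n₀ total more than 4cH over
the good arms or over the bad ones, H being the sum of Δ⁻² over that group. Every extra pull of a
bad arm happens while it beats a fixed good arm; every well-sampled good arm is, at time t,
nonpositive or beaten by a bad arm. These events decay exponentially in the number of pulls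
(`IsBanditProcess.measure_pair_le`, `IsBanditProcess.measure_pair_tail_le`). Instead of a union
bound over arms, Markov's inequality is applied to the total excess of pulls over 4(c − 1)/Δ_a² in
each group (`measure_excess_le`), which gives the constant 4. What remains is a numerical
inequality, `total_error_le`. -/

noncomputable section

namespace GoodArm

/-! ### A time-uniform deviation inequality for adaptive sampling -/

/-- Sum of the centred observations of arm `a` in rounds `1, …, t`. -/
def centeredSum {K : ℕ} (μ : Fin K → ℝ) (arm : ℕ → Fin K) (reward : ℕ → ℝ) (a : Fin K)
    (t : ℕ) : ℝ :=
  ∑ s ∈ Finset.range t, if arm (s + 1) = a then reward (s + 1) - μ a else 0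

/-- Increment in round `t + 1` of the logarithm of the exponential supermartingale in which the
observation following `k` pulls of arm `a` has coefficient `c a k`. -/
def logIncrement {K : ℕ} (μ : Fin K → ℝ) (c : Fin K → ℕ → ℝ) (arm : ℕ → Fin K)
    (reward : ℕ → ℝ) (t : ℕ) : ℝ :=
  c (arm (t + 1)) (numPulls arm (arm (t + 1)) t) * (reward (t + 1) - μ (arm (t + 1))) -
    c (arm (t + 1)) (numPulls arm (arm (t + 1)) t) ^ 2 / 2

/-- Logarithm of the exponential supermartingale with coefficients `c`. -/
def logWealth {K : ℕ} (μ : Fin K → ℝ) (c : Fin K → ℕ → ℝ) (arm : ℕ → Fin K)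
    (reward : ℕ → ℝ) (t : ℕ) : ℝ :=
  ∑ s ∈ Finset.range t, logIncrement μ c arm reward s

lemma numPulls_zero {K : ℕ} (arm : ℕ → Fin K) (a : Fin K) : numPulls arm a 0 = 0 := by
  simp [numPulls]

lemma numPulls_succ {K : ℕ} (arm : ℕ → Fin K) (a : Fin K) (t : ℕ) :
    numPulls arm a (t + 1) = numPulls arm a t + if arm (t + 1) = a then 1 else 0 := by
  rw [numPulls, numPulls, ← Finset.insert_Icc_right_eq_Icc_add_one (by omega : 1 ≤ t + 1),
    Finset.filter_insert]
  split_ifs with h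
  · rw [Finset.card_insert_of_notMem (by simp)]
  · rfl

section Sampling

variable {Ω : Type*} {mΩ : MeasurableSpace Ω} {K : ℕ} {P : Measure Ω}
  {ν : Fin K → Measure ℝ} {ℱ : Filtration ℕ mΩ} {arm : ℕ → Ω → Fin K} {reward : ℕ → Ω → ℝ}

/-- The conditional law is given one set at a time; integrating it over a past event on which the
arm is fixed makes it an identity of measures, with no regular conditional distribution. -/
lemma IsBanditProcess.map_reward_restrict [IsProbabilityMeasure P]
    (h : IsBanditProcess P ν ℱ arm reward) (hν : ∀ a, IsProbabilityMeasure (ν a)) (t : ℕ)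
    (a : Fin K) {S : Set Ω} (hS : MeasurableSet[ℱ t] S) (hSa : ∀ ω ∈ S, arm (t + 1) ω = a) :
    (P.restrict S).map (reward (t + 1)) = P S • ν a := by
  have hX : Measurable (reward (t + 1)) := (h.measurable_reward t).mono (ℱ.le _) le_rfl
  have hS' : MeasurableSet S := ℱ.le t _ hS
  ext s hs
  rw [Measure.map_apply hX hs, Measure.restrict_apply (hX hs), Measure.smul_apply, smul_eq_mul]
  have h1 : ∫ ω in S, (P⟦reward (t + 1) ⁻¹' s | ℱ t⟧) ω ∂P =
      ∫ ω in S, (reward (t + 1) ⁻¹' s).indicator (fun _ => (1 : ℝ)) ω ∂P :=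
    setIntegral_condExp (ℱ.le t) ((integrable_const _).indicator (hX hs)) hS
  have h2 : ∫ ω in S, (P⟦reward (t + 1) ⁻¹' s | ℱ t⟧) ω ∂P = ∫ ω in S, (ν a).real s ∂P := by
    refine setIntegral_congr_ae hS' ?_
    filter_upwards [h.condLaw t s hs] with ω hω hωS
    rw [hω, hSa ω hωS]
  rw [h2, integral_indicator_const _ (hX hs), setIntegral_const] at h1
  simp only [smul_eq_mul, mul_one, measureReal_def] at h1
  rw [Measure.restrict_apply (hX hs), ← ENNReal.toReal_mul] at h1
  exact ((ENNReal.toReal_eq_toReal_iff' (by finiteness) (by finiteness)).1 h1).symm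

lemma IsBanditProcess.setLIntegral_mul_reward [IsProbabilityMeasure P]
    (h : IsBanditProcess P ν ℱ arm reward) (hν : ∀ a, IsProbabilityMeasure (ν a)) (t : ℕ)
    (a : Fin K) {S : Set Ω} (hS : MeasurableSet[ℱ t] S) (hSa : ∀ ω ∈ S, arm (t + 1) ω = a)
    {g : ℝ → ENNReal} (hg : Measurable g) {f : Ω → ENNReal} (hf : Measurable[ℱ t] f) :
    ∫⁻ ω in S, f ω * g (reward (t + 1) ω) ∂P = (∫⁻ ω in S, f ω ∂P) * ∫⁻ x, g x ∂(ν a) := by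
  have hX : Measurable (reward (t + 1)) := (h.measurable_reward t).mono (ℱ.le _) le_rfl
  have hgX : Measurable fun ω => g (reward (t + 1) ω) := hg.comp hX
  refine @Measurable.ennreal_induction Ω (ℱ t) (fun f =>
    ∫⁻ ω in S, f ω * g (reward (t + 1) ω) ∂P = (∫⁻ ω in S, f ω ∂P) * ∫⁻ x, g x ∂(ν a))
    ?_ ?_ ?_ f hf
  · intro c A hA
    have hA' : MeasurableSet A := ℱ.le t _ hA
    have e1 : ∀ ω, A.indicator (fun _ => c) ω * g (reward (t + 1) ω) =
        A.indicator (fun ω => c * g (reward (t + 1) ω)) ω := fun ω => by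
      by_cases hω : ω ∈ A <;> simp [hω]
    have e2 := h.map_reward_restrict hν t a (S := A ∩ S) (hA.inter hS) fun ω hω => hSa ω hω.2
    simp only [e1]
    rw [lintegral_indicator hA', lintegral_indicator hA', setLIntegral_const,
      lintegral_const_mul _ hgX, Measure.restrict_restrict hA', Measure.restrict_apply hA',
      ← lintegral_map (μ := P.restrict (A ∩ S)) hg hX, e2, lintegral_smul_measure, smul_eq_mul,
      mul_assoc]
  · intro f₁ f₂ _ h1 _ e1 e2
    have h1' : Measurable f₁ := h1.mono (ℱ.le t) le_rfl
    simp only [Pi.add_apply, add_mul]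
    rw [lintegral_add_left (show Measurable fun ω => f₁ ω * g (reward (t + 1) ω) from h1'.mul hgX),
      lintegral_add_left h1', e1, e2, add_mul]
  · intro F hF hmono e
    have hF' : ∀ n, Measurable (F n) := fun n => (hF n).mono (ℱ.le t) le_rfl
    simp only [ENNReal.iSup_mul]
    rw [lintegral_iSup
      (fun n => show Measurable fun ω => F n ω * g (reward (t + 1) ω) from (hF' n).mul hgX)
      (fun i j hij ω => mul_le_mul_left (hmono hij ω) _), lintegral_iSup hF' hmono,
      ENNReal.iSup_mul]
    exact iSup_congr e

lemma IsOneSubGaussian.lintegral_exp_le {ν₀ : Measure ℝ} {μ₀ : ℝ} (h : IsOneSubGaussian ν₀ μ₀)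
    (c : ℝ) : ∫⁻ x, ENNReal.ofReal (Real.exp (c * (x - μ₀) - c ^ 2 / 2)) ∂ν₀ ≤ 1 := by
  have e : ∀ x, Real.exp (c * (x - μ₀) - c ^ 2 / 2) =
      Real.exp (c * (x - μ₀)) * Real.exp (-(c ^ 2 / 2)) := fun x => by
    rw [← Real.exp_add, sub_eq_add_neg]
  have hi := h.subgaussian.integrable_exp_mul c
  rw [← ofReal_integral_eq_lintegral_ofReal]
  · simp only [e]
    rw [integral_mul_const, ← ENNReal.ofReal_one]
    refine ENNReal.ofReal_le_ofReal ?_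
    have h1 := h.subgaussian.mgf_le c
    rw [mgf] at h1
    calc _ ≤ Real.exp (((1 : NNReal) : ℝ) * c ^ 2 / 2) * Real.exp (-(c ^ 2 / 2)) := by gcongr
      _ = 1 := by rw [← Real.exp_add]; simp
  · simp only [e]
    exact hi.mul_const _
  · exact Eventually.of_forall fun x => (Real.exp_pos _).le

lemma IsBanditProcess.measurable_numPulls (h : IsBanditProcess P ν ℱ arm reward) (a : Fin K)
    (t : ℕ) : Measurable[ℱ t] fun ω => numPulls (fun s => arm s ω) a t := by
  induction t with
  | zero => simp only [numPulls_zero]; exact measurable_const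
  | succ t ih =>
    simp only [numPulls_succ]
    refine Measurable.add (ih.mono (ℱ.mono t.le_succ) le_rfl) ?_
    refine Measurable.ite ?_ measurable_const measurable_const
    exact ((h.measurable_arm t).mono (ℱ.mono t.le_succ) le_rfl) (measurableSet_singleton a)

/-- Supermartingale step. On each cell of the countable partition by the arm pulled and its pull
count, the coefficient is constant, the past factors out, and sub-Gaussianity bounds the remaining
integral by 1. -/
lemma IsBanditProcess.lintegral_mul_exp_logIncrement_le [IsProbabilityMeasure P]
    (h : IsBanditProcess P ν ℱ arm reward) {μ : Fin K → ℝ}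
    (hν : ∀ a, IsOneSubGaussian (ν a) (μ a)) (c : Fin K → ℕ → ℝ) (t : ℕ) {f : Ω → ENNReal}
    (hf : Measurable[ℱ t] f) :
    ∫⁻ ω, f ω * ENNReal.ofReal
      (Real.exp (logIncrement μ c (fun s => arm s ω) (fun s => reward s ω) t)) ∂P ≤
      ∫⁻ ω, f ω ∂P := by
  let S : Fin K × ℕ → Set Ω := fun y =>
    {ω | arm (t + 1) ω = y.1} ∩ {ω | numPulls (fun s => arm s ω) y.1 t = y.2}
  have hS : ∀ y, MeasurableSet[ℱ t] (S y) := fun y =>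
    ((h.measurable_arm t) (measurableSet_singleton y.1)).inter
      ((h.measurable_numPulls y.1 t) (measurableSet_singleton y.2))
  have hS' : ∀ y, MeasurableSet (S y) := fun y => ℱ.le t _ (hS y)
  have hU : ⋃ y, S y = Set.univ := by
    refine Set.eq_univ_of_forall fun ω => Set.mem_iUnion.2
      ⟨(arm (t + 1) ω, numPulls (fun s => arm s ω) (arm (t + 1) ω) t), rfl, rfl⟩
  have hd : Pairwise (Function.onFun Disjoint S) := by
    rintro ⟨a, k⟩ ⟨b, l⟩ hne
    refine Set.disjoint_left.2 ?_
    rintro ω ⟨h1, h2⟩ ⟨h3, h4⟩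
    simp only [Set.mem_ofPred_eq] at h1 h2 h3 h4
    refine hne ?_
    obtain rfl : a = b := h1.symm.trans h3
    exact Prod.ext rfl (h2.symm.trans h4)
  rw [← setLIntegral_univ, ← setLIntegral_univ (μ := P) f, ← hU, lintegral_iUnion hS' hd,
    lintegral_iUnion hS' hd]
  refine ENNReal.tsum_le_tsum fun y => ?_
  have e := h.setLIntegral_mul_reward (fun a => (hν a).isProbabilityMeasure) t y.1 (hS y)
    (fun ω hω => hω.1) (g := fun x =>
      ENNReal.ofReal (Real.exp (c y.1 y.2 * (x - μ y.1) - c y.1 y.2 ^ 2 / 2))) (by fun_prop) hf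
  calc _ = _ := setLIntegral_congr_fun (hS' y) ?_
    _ = _ := e
    _ ≤ _ := mul_le_of_le_one_right' ((hν y.1).lintegral_exp_le _)
  rintro ω ⟨h1, h2⟩
  simp only [Set.mem_ofPred_eq] at h1 h2
  simp only [logIncrement, h1, h2]

lemma IsBanditProcess.measurable_logIncrement (h : IsBanditProcess P ν ℱ arm reward)
    (μ : Fin K → ℝ) (c : Fin K → ℕ → ℝ) (t : ℕ) :
    Measurable[ℱ (t + 1)] fun ω =>
      logIncrement μ c (fun s => arm s ω) (fun s => reward s ω) t := by
  have ha : Measurable[ℱ (t + 1)] (arm (t + 1)) :=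
    (h.measurable_arm t).mono (ℱ.mono t.le_succ) le_rfl
  have hN : Measurable[ℱ (t + 1)] fun ω => fun a => numPulls (fun s => arm s ω) a t :=
    @measurable_pi_lambda _ _ _ (ℱ (t + 1)) _ _ fun a =>
      (h.measurable_numPulls a t).mono (ℱ.mono t.le_succ) le_rfl
  have hr := h.measurable_reward t
  have hc : Measurable fun p : Fin K × (Fin K → ℕ) => c p.1 (p.2 p.1) := measurable_of_countable _
  have h1 := hc.comp (ha.prodMk hN)
  have h2 : Measurable[ℱ (t + 1)] fun ω => μ (arm (t + 1) ω) := (measurable_of_countable μ).comp ha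
  exact (h1.mul (hr.sub h2)).sub ((h1.pow_const 2).div_const 2)

/-- The exponential supermartingale stopped once it reaches the level `exp x`. -/
def stoppedWealth {K : ℕ} (μ : Fin K → ℝ) (c : Fin K → ℕ → ℝ) (x : ℝ) (arm : ℕ → Fin K)
    (reward : ℕ → ℝ) : ℕ → ENNReal
  | 0 => 1
  | t + 1 =>
    if ENNReal.ofReal (Real.exp x) ≤ stoppedWealth μ c x arm reward t then
      stoppedWealth μ c x arm reward t
    else stoppedWealth μ c x arm reward t *
      ENNReal.ofReal (Real.exp (logIncrement μ c arm reward t))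

lemma stoppedWealth_eq_or {K : ℕ} (μ : Fin K → ℝ) (c : Fin K → ℕ → ℝ) (x : ℝ)
    (arm : ℕ → Fin K) (reward : ℕ → ℝ) (t : ℕ) :
    ENNReal.ofReal (Real.exp x) ≤ stoppedWealth μ c x arm reward t ∨
      stoppedWealth μ c x arm reward t =
        ENNReal.ofReal (Real.exp (logWealth μ c arm reward t)) := by
  induction t with
  | zero => right; simp [stoppedWealth, logWealth]
  | succ t ih =>
    rw [stoppedWealth]
    split_ifs with hx
    · exact Or.inl hx
    · right
      rw [ih.resolve_left hx, ← ENNReal.ofReal_mul (Real.exp_pos _).le, ← Real.exp_add, logWealth,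
        logWealth, Finset.sum_range_succ]

lemma stoppedWealth_mono_level {K : ℕ} (μ : Fin K → ℝ) (c : Fin K → ℕ → ℝ) (x : ℝ)
    (arm : ℕ → Fin K) (reward : ℕ → ℝ) {s t : ℕ} (hst : s ≤ t)
    (hs : ENNReal.ofReal (Real.exp x) ≤ stoppedWealth μ c x arm reward s) :
    ENNReal.ofReal (Real.exp x) ≤ stoppedWealth μ c x arm reward t := by
  induction t, hst using Nat.le_induction with
  | base => exact hs
  | succ t _ ih => rw [stoppedWealth, if_pos ih]; exact ih

lemma IsBanditProcess.measurable_stoppedWealth (h : IsBanditProcess P ν ℱ arm reward)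
    (μ : Fin K → ℝ) (c : Fin K → ℕ → ℝ) (x : ℝ) (t : ℕ) :
    Measurable[ℱ t] fun ω => stoppedWealth μ c x (fun s => arm s ω) (fun s => reward s ω) t := by
  induction t with
  | zero => simp only [stoppedWealth]; exact measurable_const
  | succ t ih =>
    have ih' := ih.mono (ℱ.mono t.le_succ) le_rfl
    simp only [stoppedWealth]
    refine Measurable.ite (ih' measurableSet_Ici) ih' (ih'.mul ?_)
    exact ENNReal.measurable_ofReal.comp
      (Real.measurable_exp.comp (h.measurable_logIncrement μ c t))

lemma IsBanditProcess.lintegral_stoppedWealth_le [IsProbabilityMeasure P]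
    (h : IsBanditProcess P ν ℱ arm reward) {μ : Fin K → ℝ}
    (hν : ∀ a, IsOneSubGaussian (ν a) (μ a)) (c : Fin K → ℕ → ℝ) (x : ℝ) (t : ℕ) :
    ∫⁻ ω, stoppedWealth μ c x (fun s => arm s ω) (fun s => reward s ω) t ∂P ≤ 1 := by
  induction t with
  | zero => simp [stoppedWealth]
  | succ t ih =>
    have hm := h.measurable_stoppedWealth μ c x t
    set M : Ω → ENNReal :=
      fun ω => stoppedWealth μ c x (fun s => arm s ω) (fun s => reward s ω) t with hM
    have hA : MeasurableSet[ℱ t] {ω | ENNReal.ofReal (Real.exp x) ≤ M ω} :=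
      hm measurableSet_Ici
    set A := {ω | ENNReal.ofReal (Real.exp x) ≤ M ω}
    have hA' : MeasurableSet A := ℱ.le t _ hA
    have hm' : Measurable M := hm.mono (ℱ.le t) le_rfl
    refine le_trans ?_ ih
    calc _ = ∫⁻ ω, A.indicator M ω + Aᶜ.indicator M ω * ENNReal.ofReal
          (Real.exp (logIncrement μ c (fun s => arm s ω) (fun s => reward s ω) t)) ∂P := by
          refine lintegral_congr fun ω => ?_
          rw [stoppedWealth]
          by_cases hω : ω ∈ A
          · rw [if_pos (show _ ≤ M ω from hω)]; simp [hω, hM]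
          · rw [if_neg (show ¬_ ≤ M ω from hω)]; simp [hω, hM]
      _ = ∫⁻ ω, A.indicator M ω ∂P + ∫⁻ ω, Aᶜ.indicator M ω * ENNReal.ofReal
          (Real.exp (logIncrement μ c (fun s => arm s ω) (fun s => reward s ω) t)) ∂P :=
          lintegral_add_left (hm'.indicator hA') _
      _ ≤ ∫⁻ ω, A.indicator M ω ∂P + ∫⁻ ω, Aᶜ.indicator M ω ∂P := by
          refine add_le_add le_rfl ?_
          exact h.lintegral_mul_exp_logIncrement_le hν c t (hm.indicator hA.compl)
      _ = ∫⁻ ω, M ω ∂P := by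
          rw [← lintegral_add_left (hm'.indicator hA')]
          exact lintegral_congr fun ω => Set.indicator_self_add_compl_apply A M ω

/-- Maximal inequality for the exponential supermartingale. -/
theorem IsBanditProcess.measure_exists_le_logWealth_le [IsProbabilityMeasure P]
    (h : IsBanditProcess P ν ℱ arm reward) {μ : Fin K → ℝ}
    (hν : ∀ a, IsOneSubGaussian (ν a) (μ a)) (c : Fin K → ℕ → ℝ) (x : ℝ) :
    P {ω | ∃ t, x ≤ logWealth μ c (fun s => arm s ω) (fun s => reward s ω) t} ≤
      ENNReal.ofReal (Real.exp (-x)) := by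
  let M : ℕ → Ω → ENNReal :=
    fun t ω => stoppedWealth μ c x (fun s => arm s ω) (fun s => reward s ω) t
  have hsub : {ω | ∃ t, x ≤ logWealth μ c (fun s => arm s ω) (fun s => reward s ω) t} ⊆
      ⋃ t, {ω | ENNReal.ofReal (Real.exp x) ≤ M t ω} := by
    rintro ω ⟨t, ht⟩
    refine Set.mem_iUnion.2 ⟨t, ?_⟩
    rcases stoppedWealth_eq_or μ c x (fun s => arm s ω) (fun s => reward s ω) t with h1 | h1
    · exact h1
    · exact (ENNReal.ofReal_le_ofReal (Real.exp_le_exp.2 ht)).trans_eq h1.symm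
  -- Freezing the process at its first crossing makes these events increasing in t, so Markov's
  -- inequality at each fixed time passes to their union.
  have hmono : Monotone fun t => {ω | ENNReal.ofReal (Real.exp x) ≤ M t ω} :=
    fun s t hst ω hω => stoppedWealth_mono_level _ _ _ _ _ hst hω
  refine (measure_mono hsub).trans ?_
  rw [hmono.measure_iUnion]
  refine iSup_le fun t => ?_
  have hm : Measurable (M t) := (h.measurable_stoppedWealth μ c x t).mono (ℱ.le t) le_rfl
  have h0 : ENNReal.ofReal (Real.exp x) ≠ 0 := by simp [Real.exp_pos]
  calc _ ≤ (∫⁻ ω, M t ω ∂P) / ENNReal.ofReal (Real.exp x) :=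
        meas_ge_le_lintegral_div hm.aemeasurable h0 ENNReal.ofReal_ne_top
    _ ≤ 1 / ENNReal.ofReal (Real.exp x) := by
        gcongr
        exact h.lintegral_stoppedWealth_le hν c x t
    _ = ENNReal.ofReal (Real.exp (-x)) := by
        rw [one_div, Real.exp_neg, ENNReal.ofReal_inv_of_pos (Real.exp_pos x)]

end Sampling

/-! ### Trajectories -/

section Trajectory

variable {K : ℕ} {θ : ℝ} {μ : Fin K → ℝ} {arm : ℕ → Fin K} {reward : ℕ → ℝ}

/-- The signed statistic `√N_a(t) * (empirical mean - θ)`. -/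
def signedStat {K : ℕ} (θ : ℝ) (arm : ℕ → Fin K) (reward : ℕ → ℝ) (a : Fin K) (t : ℕ) : ℝ :=
  √(numPulls arm a t : ℝ) * (empMean arm reward a t - θ)

lemma centeredSum_succ (a : Fin K) (t : ℕ) :
    centeredSum μ arm reward a (t + 1) = centeredSum μ arm reward a t +
      if arm (t + 1) = a then reward (t + 1) - μ a else 0 := by
  rw [centeredSum, centeredSum, Finset.sum_range_succ]

lemma numPulls_mono (a : Fin K) : Monotone (numPulls arm a) :=
  monotone_nat_of_le_succ fun t => by rw [numPulls_succ]; omega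

lemma sum_numPulls (t : ℕ) : ∑ a, numPulls arm a t = t := by
  induction t with
  | zero => simp [numPulls_zero]
  | succ t ih => simp [numPulls_succ, Finset.sum_add_distrib, ih]

lemma exists_pull {a : Fin K} {k t : ℕ} (hk : k < numPulls arm a t) :
    ∃ s < t, numPulls arm a s = k ∧ arm (s + 1) = a := by
  induction t with
  | zero => simp [numPulls_zero] at hk
  | succ t ih =>
    by_cases h : k < numPulls arm a t
    · obtain ⟨s, hs, h'⟩ := ih h
      exact ⟨s, by omega, h'⟩
    · rw [numPulls_succ] at hk
      split_ifs at hk with ha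
      · exact ⟨t, by omega, by omega, ha⟩
      · omega

lemma sum_reward_eq (a : Fin K) (t : ℕ) :
    ∑ s ∈ (Finset.Icc 1 t).filter (fun s => arm s = a), reward s =
      centeredSum μ arm reward a t + μ a * numPulls arm a t := by
  induction t with
  | zero => simp [centeredSum, numPulls]
  | succ t ih =>
    rw [← Finset.insert_Icc_right_eq_Icc_add_one (by omega : 1 ≤ t + 1), Finset.filter_insert,
      centeredSum_succ, numPulls_succ]
    split_ifs with h
    · rw [Finset.sum_insert (by simp), ih]
      push_cast
      ring
    · rw [ih]
      push_cast
      ring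

lemma centeredSum_eq (μ : Fin K → ℝ) {a : Fin K} {t : ℕ} (h : 0 < numPulls arm a t) :
    centeredSum μ arm reward a t =
      √(numPulls arm a t : ℝ) * signedStat θ arm reward a t + (θ - μ a) * numPulls arm a t := by
  have hN : (0 : ℝ) < numPulls arm a t := by exact_mod_cast h
  rw [signedStat, empMean, sum_reward_eq (μ := μ), ← mul_assoc, Real.mul_self_sqrt hN.le]
  field_simp
  ring

lemma logWealth_succ (c : Fin K → ℕ → ℝ) (t : ℕ) :
    logWealth μ c arm reward (t + 1) =
      logWealth μ c arm reward t + logIncrement μ c arm reward t := by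
  rw [logWealth, logWealth, Finset.sum_range_succ]

lemma logWealth_const (l : Fin K → ℝ) (t : ℕ) :
    logWealth μ (fun a _ => l a) arm reward t =
      ∑ a, (l a * centeredSum μ arm reward a t - l a ^ 2 / 2 * numPulls arm a t) := by
  induction t with
  | zero => simp [logWealth, centeredSum, numPulls_zero]
  | succ t ih =>
    rw [logWealth_succ, ih, logIncrement]
    have h : ∀ a, l a * centeredSum μ arm reward a (t + 1) -
        l a ^ 2 / 2 * (numPulls arm a (t + 1) : ℕ) =
        (l a * centeredSum μ arm reward a t - l a ^ 2 / 2 * numPulls arm a t) +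
        if arm (t + 1) = a then l a * (reward (t + 1) - μ a) - l a ^ 2 / 2 else 0 := fun a => by
      rw [centeredSum_succ, numPulls_succ]
      split_ifs
      · push_cast
        ring
      · push_cast
        ring
    simp only [h, Finset.sum_add_distrib, Finset.sum_ite_eq, Finset.mem_univ, if_true]

lemma logWealth_single (a : Fin K) (x : ℝ) (t : ℕ) :
    logWealth μ (fun i _ => if i = a then x else 0) arm reward t =
      x * centeredSum μ arm reward a t - x ^ 2 / 2 * numPulls arm a t := by
  rw [logWealth_const, Finset.sum_eq_single a]
  · simp
  · intro b _ hb
    simp [hb]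
  · simp

lemma logWealth_pair {a b : Fin K} (hab : a ≠ b) (x y : ℝ) (t : ℕ) :
    logWealth μ (fun i _ => if i = a then x else if i = b then y else 0) arm reward t =
      (x * centeredSum μ arm reward a t - x ^ 2 / 2 * numPulls arm a t) +
      (y * centeredSum μ arm reward b t - y ^ 2 / 2 * numPulls arm b t) := by
  rw [logWealth_const, Finset.sum_eq_add a b hab]
  · simp [hab.symm]
  · rintro i _ ⟨h1, h2⟩
    simp [h1, h2]
  · simp
  · simp

/-- The bound is ≤ n and not < n because the coefficient of a pull is read at the count before that
pull. -/
lemma logWealth_switch_of_le {a : Fin K} {n : ℕ} (x y : ℝ) {s : ℕ}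
    (hs : numPulls arm a s ≤ n) :
    logWealth μ (fun i k => if i = a then if k < n then x else y else 0) arm reward s =
      x * centeredSum μ arm reward a s - x ^ 2 / 2 * numPulls arm a s := by
  induction s with
  | zero => simp [logWealth, centeredSum, numPulls_zero]
  | succ s ih =>
    rw [logWealth_succ, logIncrement, centeredSum_succ, numPulls_succ,
      ih ((numPulls_mono a s.le_succ).trans hs)]
    rw [numPulls_succ] at hs
    by_cases h : arm (s + 1) = a
    · simp only [h, if_true] at hs ⊢
      rw [if_pos (by omega)]
      push_cast
      ring
    · simp [h]

lemma logWealth_switch {a : Fin K} {n : ℕ} (x y : ℝ) {s t : ℕ} (hst : s ≤ t)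
    (hs : numPulls arm a s = n) :
    logWealth μ (fun i k => if i = a then if k < n then x else y else 0) arm reward t =
      x * centeredSum μ arm reward a s - x ^ 2 / 2 * n +
      (y * (centeredSum μ arm reward a t - centeredSum μ arm reward a s) -
        y ^ 2 / 2 * (numPulls arm a t - n)) := by
  induction t, hst using Nat.le_induction with
  | base => rw [logWealth_switch_of_le x y hs.le, hs]; ring
  | succ t hst ih =>
    rw [logWealth_succ, logIncrement, centeredSum_succ, numPulls_succ, ih]
    by_cases h : arm (t + 1) = a
    · have : n ≤ numPulls arm a t := hs ▸ numPulls_mono a hst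
      simp only [h, if_true]
      rw [if_neg (by omega)]
      push_cast
      ring
    · simp [h]

lemma max_mul_zero {x y : ℝ} (hx : 0 ≤ x) : x * max y 0 = max (x * y) 0 := by
  rw [mul_max_of_nonneg _ _ hx, mul_zero]

lemma FollowsAPGAI.le_numPulls {n₀ : ℕ} {guess : ℕ → Option (Fin K)}
    (h : FollowsAPGAI n₀ θ arm reward guess) (a : Fin K) {t : ℕ} (ht : n₀ * K ≤ t) :
    n₀ ≤ numPulls arm a t :=
  (h.1 a).symm.trans_le (numPulls_mono a ht)

/-- APGAI always pulls an arm with the largest signed statistic. -/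
lemma FollowsAPGAI.signedStat_le {n₀ : ℕ} (hn₀ : 0 < n₀) {guess : ℕ → Option (Fin K)}
    (h : FollowsAPGAI n₀ θ arm reward guess) {t : ℕ} (ht : n₀ * K ≤ t) (b : Fin K) :
    signedStat θ arm reward b t ≤ signedStat θ arm reward (arm (t + 1)) t := by
  have hs : ∀ a, 0 < √(numPulls arm a t : ℝ) := fun a =>
    Real.sqrt_pos.2 (by exact_mod_cast hn₀.trans_le (h.le_numPulls a ht))
  have hpos : ∀ a, Wpos θ arm reward a t = max (signedStat θ arm reward a t) 0 := fun a =>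
    max_mul_zero (hs a).le
  have hneg : ∀ a, Wneg θ arm reward a t = max (-signedStat θ arm reward a t) 0 := fun a => by
    rw [Wneg, max_mul_zero (hs a).le, signedStat, mul_neg]
  by_cases hc : ∀ a, empMean arm reward a t ≤ θ
  · have h1 := ((h.2 t ht).1 hc).2 b
    have h2 : ∀ a, signedStat θ arm reward a t ≤ 0 := fun a =>
      mul_nonpos_of_nonneg_of_nonpos (hs a).le (by linarith [hc a])
    rw [hneg, hneg, max_eq_left (by linarith [h2 (arm (t + 1))]),
      max_eq_left (by linarith [h2 b])] at h1
    linarith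
  · have h1 := ((h.2 t ht).2 hc).2
    push Not at hc
    obtain ⟨d, hd⟩ := hc
    have hd' : 0 < signedStat θ arm reward d t := mul_pos (hs d) (by linarith)
    have h2 := h1 d
    have h3 := h1 b
    rw [hpos, hpos] at h2 h3
    have h4 : 0 < signedStat θ arm reward (arm (t + 1)) t := by
      by_contra! h5
      rw [max_eq_right h5] at h2
      linarith [le_max_left (signedStat θ arm reward d t) 0]
    rw [max_eq_left h4.le] at h3
    exact (le_max_left _ _).trans h3

lemma FollowsAPGAI.guess_spec {n₀ : ℕ} (hn₀ : 0 < n₀) {guess : ℕ → Option (Fin K)}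
    (h : FollowsAPGAI n₀ θ arm reward guess) {t : ℕ} (ht : n₀ * K ≤ t) :
    (guess t = none ∧ ∀ a, signedStat θ arm reward a t ≤ 0) ∨
      (guess t = some (arm (t + 1)) ∧ 0 < signedStat θ arm reward (arm (t + 1)) t) := by
  have hs : ∀ a, 0 < √(numPulls arm a t : ℝ) := fun a =>
    Real.sqrt_pos.2 (by exact_mod_cast hn₀.trans_le (h.le_numPulls a ht))
  by_cases hc : ∀ a, empMean arm reward a t ≤ θ
  · exact Or.inl ⟨((h.2 t ht).1 hc).1, fun a =>
      mul_nonpos_of_nonneg_of_nonpos (hs a).le (by linarith [hc a])⟩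
  · refine Or.inr ⟨((h.2 t ht).2 hc).1, ?_⟩
    push Not at hc
    obtain ⟨d, hd⟩ := hc
    exact (mul_pos (hs d) (by linarith)).trans_le (h.signedStat_le hn₀ ht d)

end Trajectory

/-! ### Deviation events -/

/-- Number of pulls of arm `a` up to round `t` on the outcome `ω`. -/
abbrev pulls {Ω : Type*} {K : ℕ} (arm : ℕ → Ω → Fin K) (a : Fin K) (t : ℕ) (ω : Ω) : ℕ :=
  numPulls (fun s => arm s ω) a t

/-- Signed statistic of arm `a` after round `t` on the outcome `ω`. -/
abbrev stat {Ω : Type*} {K : ℕ} (θ : ℝ) (arm : ℕ → Ω → Fin K) (reward : ℕ → Ω → ℝ) (a : Fin K)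
    (t : ℕ) (ω : Ω) : ℝ :=
  signedStat θ (fun s => arm s ω) (fun s => reward s ω) a t

/-- Let D = (y + z)/2. At ρ = 1 the right side is D(W − V + 2D) − D² ≥ D². Its derivative in ρ there
is D((3z − y)/2 − V) ≥ 0, and the coefficient of ρ² is D(3z − y)/4 ≥ 0, so it does not decrease for
ρ ≥ 1. -/
lemma pair_tail_bound {y z ρ V W : ℝ} (hy : 0 ≤ y) (hz : 0 ≤ z) (hρ : 1 ≤ ρ) (hVW : V ≤ W)
    (hW : W ≤ (3 * z - y) / 2) (hyz : 0 ≤ (3 * z - y) / 2) :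
    (z ^ 2 + y ^ 2) / 4 ≤ (y + z) / 2 * (W + y) - ((y + z) / 2) ^ 2 / 2 +
      ((y + z) / 2 * (-ρ * V + ρ ^ 2 * z) - ((y + z) / 2) ^ 2 / 2 * ρ ^ 2) := by
  have h1 : 0 ≤ ρ * (W - V) := mul_nonneg (by linarith) (by linarith)
  have h2 : 0 ≤ (ρ - 1) * ((3 * z - y) / 2 - W) := mul_nonneg (by linarith) (by linarith)
  have h3 : 0 ≤ (3 * z - y) / 2 * (ρ - 1) ^ 2 := mul_nonneg hyz (sq_nonneg _)
  have h4 : (y + z) / 2 ≤ W + y - ρ * V + ρ ^ 2 * z - (y + z) / 2 / 2 * (1 + ρ ^ 2) := by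
    linarith
  have h5 := mul_le_mul_of_nonneg_left h4 (show 0 ≤ (y + z) / 2 by positivity)
  have h6 : 0 ≤ y * z := mul_nonneg hy hz
  linarith

section Events

variable {Ω : Type*} {mΩ : MeasurableSpace Ω} {K : ℕ} {P : Measure Ω} [IsProbabilityMeasure P]
  {ν : Fin K → Measure ℝ} {μ : Fin K → ℝ} {ℱ : Filtration ℕ mΩ} {arm : ℕ → Ω → Fin K}
  {reward : ℕ → Ω → ℝ} {θ : ℝ}

/-- Gaussian tail at a fixed count m, with the coefficient that is optimal for that count. -/
lemma IsBanditProcess.measure_near_le (h : IsBanditProcess P ν ℱ arm reward)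
    (hν : ∀ a, IsOneSubGaussian (ν a) (μ a)) (b : Fin K) {m : ℕ} (hm : 0 < m) {w : ℝ}
    (hw : w ≤ (θ - μ b) * √m) :
    P {ω | ∃ t, pulls arm b t ω = m ∧ -w ≤ stat θ arm reward b t ω} ≤
      ENNReal.ofReal (Real.exp (-(((θ - μ b) * √m - w) ^ 2 / 2))) := by
  have hm' : (0 : ℝ) < m := by exact_mod_cast hm
  have hr : 0 < √(m : ℝ) := Real.sqrt_pos.2 hm'
  have hrr : √(m : ℝ) * √(m : ℝ) = m := Real.mul_self_sqrt hm'.le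
  refine (measure_mono ?_).trans (h.measure_exists_le_logWealth_le hν
    (fun i _ => if i = b then ((θ - μ b) * √m - w) / √m else 0) _)
  rintro ω ⟨t, ht, hW⟩
  refine ⟨t, ?_⟩
  change numPulls _ _ _ = m at ht
  change -w ≤ signedStat _ _ _ _ _ at hW
  rw [logWealth_single, centeredSum_eq (θ := θ) μ (hm.trans_eq ht.symm), ht]
  set W := signedStat θ (fun s => arm s ω) (fun s => reward s ω) b t
  set r := √(m : ℝ)
  set x := ((θ - μ b) * r - w) / r with hx
  have hxr : x * r = (θ - μ b) * r - w := div_mul_cancel₀ _ hr.ne'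
  have hy : 0 ≤ (θ - μ b) * r - w := by linarith
  have e : x * (r * W + (θ - μ b) * m) - x ^ 2 / 2 * m =
      (x * r) * (W + (θ - μ b) * r) - (x * r) ^ 2 / 2 := by rw [← hrr]; ring
  rw [e, hxr]
  nlinarith [mul_le_mul_of_nonneg_left hW hy]

/-- With coefficient d = θ − μ_b, a nonnegative statistic at count N forces log-wealth at least
d²N/2. This increases with N, so one supermartingale covers all counts from m on. -/
lemma IsBanditProcess.measure_nonneg_le (h : IsBanditProcess P ν ℱ arm reward)
    (hν : ∀ a, IsOneSubGaussian (ν a) (μ a)) {b : Fin K} (hb : μ b < θ) {m : ℕ} (hm : 0 < m) :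
    P {ω | ∃ t, m ≤ pulls arm b t ω ∧ 0 ≤ stat θ arm reward b t ω} ≤
      ENNReal.ofReal (Real.exp (-((θ - μ b) ^ 2 * m / 2))) := by
  refine (measure_mono ?_).trans (h.measure_exists_le_logWealth_le hν
    (fun i _ => if i = b then θ - μ b else 0) _)
  rintro ω ⟨t, ht, hW⟩
  refine ⟨t, ?_⟩
  rw [logWealth_single, centeredSum_eq (θ := θ) μ (hm.trans_le ht)]
  have h1 : (m : ℝ) ≤ numPulls (fun s => arm s ω) b t := by exact_mod_cast ht
  have h2 := mul_nonneg (Real.sqrt_nonneg (numPulls (fun s => arm s ω) b t)) hW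
  have h3 := mul_nonneg (sub_pos.2 hb).le h2
  nlinarith [mul_le_mul_of_nonneg_left h1 (sq_nonneg (θ - μ b))]

lemma IsBanditProcess.measure_nonpos_le (h : IsBanditProcess P ν ℱ arm reward)
    (hν : ∀ a, IsOneSubGaussian (ν a) (μ a)) {b : Fin K} (hb : θ < μ b) {m : ℕ} (hm : 0 < m) :
    P {ω | ∃ t, m ≤ pulls arm b t ω ∧ stat θ arm reward b t ω ≤ 0} ≤
      ENNReal.ofReal (Real.exp (-((θ - μ b) ^ 2 * m / 2))) := by
  refine (measure_mono ?_).trans (h.measure_exists_le_logWealth_le hν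
    (fun i _ => if i = b then θ - μ b else 0) _)
  rintro ω ⟨t, ht, hW⟩
  refine ⟨t, ?_⟩
  rw [logWealth_single, centeredSum_eq (θ := θ) μ (hm.trans_le ht)]
  have h1 : (m : ℝ) ≤ numPulls (fun s => arm s ω) b t := by exact_mod_cast ht
  have h2 := mul_nonpos_of_nonneg_of_nonpos (Real.sqrt_nonneg (numPulls (fun s => arm s ω) b t)) hW
  have h3 := mul_nonneg_of_nonpos_of_nonpos (sub_neg.2 hb).le h2
  nlinarith [mul_le_mul_of_nonneg_left h1 (sq_nonneg (θ - μ b))]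

/-- Let d = θ − μ_a. With coefficient 2d the increment is exactly 2d(X − θ), so the climb from level
−w back to 0 earns at least 2dw√n whatever its length. Before the n-th pull the coefficient d − w/√n
is tuned so that the total is at least w²/2 + d²n/2. -/
lemma IsBanditProcess.measure_return_le (h : IsBanditProcess P ν ℱ arm reward)
    (hν : ∀ a, IsOneSubGaussian (ν a) (μ a)) {a : Fin K} (ha : μ a < θ) {n : ℕ} (hn : 0 < n)
    {w : ℝ} (hw : 0 ≤ w) :
    P {ω | ∃ s t, s ≤ t ∧ pulls arm a s ω = n ∧ stat θ arm reward a s ω ≤ -w ∧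
        0 ≤ stat θ arm reward a t ω} ≤
      ENNReal.ofReal (Real.exp (-(w ^ 2 / 2 + (θ - μ a) ^ 2 * n / 2))) := by
  have hn' : (0 : ℝ) < n := by exact_mod_cast hn
  have hr : 0 < √(n : ℝ) := Real.sqrt_pos.2 hn'
  have hrr : √(n : ℝ) * √(n : ℝ) = n := Real.mul_self_sqrt hn'.le
  have hd : 0 < θ - μ a := sub_pos.2 ha
  refine (measure_mono ?_).trans (h.measure_exists_le_logWealth_le hν
    (fun i k => if i = a then if k < n then (θ - μ a) - w / √n else 2 * (θ - μ a) else 0) _)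
  rintro ω ⟨s, t, hst, hs, hW, hW'⟩
  refine ⟨t, ?_⟩
  change numPulls _ _ _ = n at hs
  have hNt : n ≤ numPulls (fun s => arm s ω) a t := hs ▸ numPulls_mono a hst
  rw [logWealth_switch _ _ hst hs, centeredSum_eq (θ := θ) μ (hn.trans_eq hs.symm),
    centeredSum_eq (θ := θ) μ (hn.trans_le hNt), hs]
  change signedStat _ _ _ _ _ ≤ -w at hW
  have h2 := mul_nonneg hd.le (mul_nonneg (Real.sqrt_nonneg (numPulls (fun s => arm s ω) a t)) hW')
  set W := signedStat θ (fun s => arm s ω) (fun s => reward s ω) a s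
  set r := √(n : ℝ)
  set d := θ - μ a
  set x := w / r with hx
  have hxr : x * r = w := div_mul_cancel₀ _ hr.ne'
  have h3 : 0 ≤ (x * r + d * r) * (-w - W) :=
    mul_nonneg (by rw [hxr]; positivity) (by linarith)
  have h4 : 0 ≤ d * r * w := by positivity
  rw [hxr] at h3
  have e : (d - x) * (r * W + d * n) - (d - x) ^ 2 / 2 * n =
      (d * r - x * r) * (W + d * r) - (d * r - x * r) ^ 2 / 2 := by rw [← hrr]; ring
  rw [e, hxr]
  have hdn : d ^ 2 * n = (d * r) ^ 2 := by rw [← hrr]; ring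
  have hdn' : d * (d * n) = (d * r) ^ 2 := by rw [← hrr]; ring
  nlinarith [h2, h3, h4, hdn, hdn']

/-- Coefficients D/√m and −D/√n weigh the two standardized sums equally; the reversed order of the
statistics yields log-wealth at least 2D² − D² = D². -/
lemma IsBanditProcess.measure_pair_le (h : IsBanditProcess P ν ℱ arm reward)
    (hν : ∀ a, IsOneSubGaussian (ν a) (μ a)) {a b : Fin K} (ha : μ a < θ) (hb : θ < μ b)
    {m n : ℕ} (hm : 0 < m) (hn : 0 < n) :
    P {ω | ∃ t, pulls arm a t ω = m ∧ pulls arm b t ω = n ∧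
        stat θ arm reward b t ω ≤ stat θ arm reward a t ω} ≤
      ENNReal.ofReal (Real.exp (-(((θ - μ a) ^ 2 * m + (θ - μ b) ^ 2 * n) / 4))) := by
  have hab : a ≠ b := by rintro rfl; linarith
  have hm' : (0 : ℝ) < m := by exact_mod_cast hm
  have hr : 0 < √(m : ℝ) := Real.sqrt_pos.2 hm'
  have hrr : √(m : ℝ) * √(m : ℝ) = m := Real.mul_self_sqrt hm'.le
  have hn' : (0 : ℝ) < n := by exact_mod_cast hn
  have hq : 0 < √(n : ℝ) := Real.sqrt_pos.2 hn'
  have hqq : √(n : ℝ) * √(n : ℝ) = n := Real.mul_self_sqrt hn'.le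
  have hd : 0 < θ - μ a := sub_pos.2 ha
  have hd' : 0 < μ b - θ := sub_pos.2 hb
  set D := ((θ - μ a) * √m + (μ b - θ) * √n) / 2 with hD
  refine (measure_mono ?_).trans (h.measure_exists_le_logWealth_le hν
    (fun i _ => if i = a then D / √m else if i = b then -(D / √n) else 0) _)
  rintro ω ⟨t, hta, htb, hW⟩
  refine ⟨t, ?_⟩
  change numPulls _ _ _ = m at hta
  change numPulls _ _ _ = n at htb
  rw [logWealth_pair hab, centeredSum_eq (θ := θ) μ (hm.trans_eq hta.symm),
    centeredSum_eq (θ := θ) μ (hn.trans_eq htb.symm), hta, htb]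
  change signedStat _ _ _ _ _ ≤ signedStat _ _ _ _ _ at hW
  set W := signedStat θ (fun s => arm s ω) (fun s => reward s ω) a t
  set V := signedStat θ (fun s => arm s ω) (fun s => reward s ω) b t
  set r := √(m : ℝ)
  set q := √(n : ℝ)
  set x := D / r with hx
  set y := D / q with hy
  have hxr : x * r = D := div_mul_cancel₀ _ hr.ne'
  have hyq : y * q = D := div_mul_cancel₀ _ hq.ne'
  have e1 : x * (r * W + (θ - μ a) * m) - x ^ 2 / 2 * m =
      (x * r) * (W + (θ - μ a) * r) - (x * r) ^ 2 / 2 := by rw [← hrr]; ring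
  have e2 : -y * (q * V + (θ - μ b) * n) - (-y) ^ 2 / 2 * n =
      (y * q) * (-V + (μ b - θ) * q) - (y * q) ^ 2 / 2 := by rw [← hqq]; ring
  rw [e1, e2, hxr, hyq, ← hrr, ← hqq]
  have hD0 : 0 ≤ D := by positivity
  have h1 := mul_nonneg hD0 (sub_nonneg.2 hW)
  have h2 : 0 ≤ ((θ - μ a) * r) * ((μ b - θ) * q) := by positivity
  nlinarith [h1, h2, hD]

/-- The count of the good arm is only bounded below, so the pair supermartingale is tuned to the
minimal count m. `pair_tail_bound` shows that further pulls cannot hurt while W_a ≤ (3z − y)/2; a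
larger W_a is itself a rare event, paid for by the first term. -/
lemma IsBanditProcess.measure_pair_tail_le (h : IsBanditProcess P ν ℱ arm reward)
    (hν : ∀ a, IsOneSubGaussian (ν a) (μ a)) {a b : Fin K} (ha : μ a < θ) (hb : θ < μ b)
    {m n : ℕ} (hm : 0 < m) (hn : 0 < n) :
    P {ω | ∃ t, pulls arm a t ω = n ∧ m ≤ pulls arm b t ω ∧ 0 ≤ stat θ arm reward a t ω ∧
        stat θ arm reward b t ω ≤ stat θ arm reward a t ω} ≤
      ENNReal.ofReal (Real.exp (-((9 * ((θ - μ b) ^ 2 * m) + (θ - μ a) ^ 2 * n) / 8))) +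
      ENNReal.ofReal (Real.exp (-(((θ - μ b) ^ 2 * m + (θ - μ a) ^ 2 * n) / 4))) := by
  have hab : a ≠ b := by rintro rfl; linarith
  have hm' : (0 : ℝ) < m := by exact_mod_cast hm
  have hr : 0 < √(m : ℝ) := Real.sqrt_pos.2 hm'
  have hrr : √(m : ℝ) * √(m : ℝ) = m := Real.mul_self_sqrt hm'.le
  have hn' : (0 : ℝ) < n := by exact_mod_cast hn
  have hq : 0 < √(n : ℝ) := Real.sqrt_pos.2 hn'
  have hqq : √(n : ℝ) * √(n : ℝ) = n := Real.mul_self_sqrt hn'.le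
  have hd : 0 < θ - μ a := sub_pos.2 ha
  have hd' : 0 < μ b - θ := sub_pos.2 hb
  set y := (θ - μ a) * √n with hy
  set z := (μ b - θ) * √m with hz
  have hy0 : 0 < y := by positivity
  have hz0 : 0 < z := by positivity
  have hyy : (θ - μ a) ^ 2 * n = y ^ 2 := by rw [← hqq]; ring
  have hzz : (θ - μ b) ^ 2 * m = z ^ 2 := by rw [← hrr]; ring
  set v := max ((3 * z - y) / 2) 0 with hv
  set D := (y + z) / 2 with hD
  have hnear := h.measure_near_le hν (θ := θ) a hn (w := -v) (by
    have : 0 ≤ v := le_max_right _ _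
    linarith)
  refine le_trans (measure_mono ?_) ((measure_union_le
    {ω | ∃ t, pulls arm a t ω = n ∧ -(-v) ≤ stat θ arm reward a t ω} _).trans (add_le_add
      (hnear.trans (ENNReal.ofReal_le_ofReal (Real.exp_le_exp.2 (neg_le_neg ?_))))
      (h.measure_exists_le_logWealth_le hν
        (fun i _ => if i = a then D / √n else if i = b then -(D / √m) else 0) _)))
  · rintro ω ⟨t, hta, htb, hWa, hW⟩
    by_cases hWv : -(-v) ≤ stat θ arm reward a t ω
    · exact Or.inl ⟨t, hta, hWv⟩
    refine Or.inr ⟨t, ?_⟩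
    change numPulls _ _ _ = n at hta
    rw [logWealth_pair hab, centeredSum_eq (θ := θ) μ (hn.trans_eq hta.symm),
      centeredSum_eq (θ := θ) μ (hm.trans_le htb), hta, hyy, hzz]
    change signedStat _ _ _ _ _ ≤ signedStat _ _ _ _ _ at hW
    change 0 ≤ signedStat _ _ _ _ _ at hWa
    change ¬_ ≤ signedStat _ _ _ _ _ at hWv
    have htb' : (m : ℝ) ≤ numPulls (fun s => arm s ω) b t := by exact_mod_cast htb
    set N : ℝ := ((numPulls (fun s => arm s ω) b t : ℕ) : ℝ)
    have hRR : √N * √N = N := Real.mul_self_sqrt (hm'.le.trans htb')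
    have hRr : √(m : ℝ) ≤ √N := Real.sqrt_le_sqrt htb'
    set W := signedStat θ (fun s => arm s ω) (fun s => reward s ω) a t
    set V := signedStat θ (fun s => arm s ω) (fun s => reward s ω) b t
    set R := √N
    set r := √(m : ℝ)
    set q := √(n : ℝ)
    have hWv' : W < (3 * z - y) / 2 := by
      rw [neg_neg, not_le, hv, lt_max_iff] at hWv
      exact hWv.resolve_right (by linarith)
    set ρ := R / r with hρ
    have hρ1 : 1 ≤ ρ := (one_le_div hr).2 hRr
    have hρR : ρ * r = R := div_mul_cancel₀ _ hr.ne'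
    have e1 : D / q * (q * W + (θ - μ a) * n) - (D / q) ^ 2 / 2 * n =
        D * (W + y) - D ^ 2 / 2 := by rw [hy, ← hqq]; field_simp
    have e2 : -(D / r) * (R * V + (θ - μ b) * N) - (-(D / r)) ^ 2 / 2 * N =
        D * (-ρ * V + ρ ^ 2 * z) - D ^ 2 / 2 * ρ ^ 2 := by
      rw [hz, ← hRR, ← hρR]; field_simp; ring
    rw [e1, e2]
    exact pair_tail_bound hy0.le hz0.le hρ1 hW hWv'.le (by linarith)
  -- Exponent of the first term: (v + y)²/2 is (3z + y)²/8 when v > 0, and y²/2 with y ≥ 3z when v =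
  -- 0.
  · rw [hyy, hzz, sub_neg_eq_add]
    rcases le_total 0 ((3 * z - y) / 2) with h0 | h0
    · rw [hv, max_eq_left h0]
      nlinarith [mul_pos hy0 hz0]
    · rw [hv, max_eq_right h0]
      nlinarith [mul_pos hy0 hz0]

end Events

/-! ### Tail sums and a Markov inequality for total excess -/

/-- Length of `[k, k + 1] ∩ [q, ∞)`. -/
def overlap (q : ℝ) (k : ℕ) : ℝ := max ((k : ℝ) + 1) q - max (k : ℝ) q

lemma overlap_nonneg (q : ℝ) (k : ℕ) : 0 ≤ overlap q k :=
  sub_nonneg.2 (max_le_max (by linarith) le_rfl)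

lemma sum_overlap (q : ℝ) (j : ℕ) :
    ∑ k ∈ Finset.range j, overlap q k = max (j : ℝ) q - max 0 q := by
  have := Finset.sum_range_sub (fun k : ℕ => max (k : ℝ) q) j
  push_cast at this
  exact this

/-- Comparison of e^{-r(k+1)} with the integral of e^{-rx} over [k, k+1] ∩ [q, ∞); summed over k it
telescopes. -/
lemma mul_overlap_le (r q : ℝ) (k : ℕ) :
    r * (overlap q k * Real.exp (-(r * (k + 1)))) ≤
      Real.exp (-(r * max (k : ℝ) q)) - Real.exp (-(r * max ((k : ℝ) + 1) q)) := by
  rcases le_total q ((k : ℝ) + 1) with h | h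
  · have e : Real.exp (-(r * max (k : ℝ) q)) =
        Real.exp (-(r * (k + 1))) * Real.exp (r * overlap q k) := by
      rw [← Real.exp_add, overlap, max_eq_left h]
      ring_nf
    rw [e, max_eq_left h]
    nlinarith [Real.add_one_le_exp (r * overlap q k), Real.exp_pos (-(r * ((k : ℝ) + 1)))]
  · rw [overlap, max_eq_right h, max_eq_right (by linarith)]
    simp

lemma tsum_overlap_le {r q : ℝ} (hr : 0 < r) (hq : 0 ≤ q) :
    ∑' k : ℕ, ENNReal.ofReal (overlap q k * Real.exp (-(r * (k + 1)))) ≤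
      ENNReal.ofReal (Real.exp (-(r * q)) / r) := by
  refine ENNReal.tsum_le_of_sum_range_le fun n => ?_
  rw [← ENNReal.ofReal_sum_of_nonneg
    fun k _ => mul_nonneg (overlap_nonneg q k) (Real.exp_pos _).le]
  refine ENNReal.ofReal_le_ofReal ((le_div_iff₀' hr).2 ?_)
  rw [Finset.mul_sum]
  refine (Finset.sum_le_sum fun k _ => mul_overlap_le r q k).trans ?_
  have := Finset.sum_range_sub' (fun k : ℕ => Real.exp (-(r * max (k : ℝ) q))) n
  push_cast at this
  rw [this, max_eq_right hq]
  linarith [Real.exp_pos (-(r * max (n : ℝ) q))]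

lemma tsum_exp_le {r : ℝ} (hr : 0 < r) :
    ∑' k : ℕ, ENNReal.ofReal (Real.exp (-(r * (k + 1)))) ≤ ENNReal.ofReal (1 / r) := by
  have h := tsum_overlap_le hr le_rfl
  have e : ∀ k : ℕ, overlap 0 k = 1 := fun k => by
    rw [overlap, max_eq_left (by positivity), max_eq_left (by positivity)]
    ring
  simpa [e] using h

/-- If arm `i` can collect `j` units only on `A i 0 ∩ … ∩ A i (j - 1)`, the probability that the
total exceeds `∑ q i` by more than `b` is at most the expected total excess divided by `b`. -/
lemma measure_excess_le {Ω ι : Type*} {mΩ : MeasurableSpace Ω} (P : Measure Ω) (S : Finset ι)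
    (A : ι → ℕ → Set Ω) (F q : ι → ℝ) (hF : ∀ i ∈ S, 0 ≤ F i) (hq : ∀ i ∈ S, 0 ≤ q i) {b : ℝ}
    (hb : 0 < b)
    (hA : ∀ i ∈ S, ∑' k, ENNReal.ofReal (overlap (q i) k) * P (A i k) ≤ ENNReal.ofReal (F i)) :
    P {ω | ∃ j : ι → ℕ, b + ∑ i ∈ S, q i < ∑ i ∈ S, (j i : ℝ) ∧
      ∀ i ∈ S, ∀ k < j i, ω ∈ A i k} ≤ ENNReal.ofReal ((∑ i ∈ S, F i) / b) := by
  -- The events need not be measurable, so measurable hulls of the same measure replace them.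
  let T : ι → ℕ → Set Ω := fun i k => toMeasurable P (A i k)
  have hT : ∀ i k, MeasurableSet (T i k) := fun i k => measurableSet_toMeasurable _ _
  let Y : Ω → ENNReal := fun ω =>
    ∑ i ∈ S, ∑' k, (T i k).indicator (fun _ => ENNReal.ofReal (overlap (q i) k)) ω
  have hYm : Measurable Y := by
    refine Finset.measurable_sum _ fun i _ => Measurable.tsum fun k => ?_
    exact measurable_const.indicator (hT i k)
  have hY : ∫⁻ ω, Y ω ∂P ≤ ENNReal.ofReal (∑ i ∈ S, F i) := by
    rw [ENNReal.ofReal_sum_of_nonneg hF, lintegral_finsetSum _ fun i _ =>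
      Measurable.tsum fun k => measurable_const.indicator (hT i k)]
    refine Finset.sum_le_sum fun i hi => ?_
    rw [lintegral_tsum fun k => (measurable_const.indicator (hT i k)).aemeasurable]
    refine le_trans (le_of_eq (tsum_congr fun k => ?_)) (hA i hi)
    rw [lintegral_indicator_const (hT i k), measure_toMeasurable]
  have hsub : {ω | ∃ j : ι → ℕ, b + ∑ i ∈ S, q i < ∑ i ∈ S, (j i : ℝ) ∧
      ∀ i ∈ S, ∀ k < j i, ω ∈ A i k} ⊆ {ω | ENNReal.ofReal b ≤ Y ω} := by
    rintro ω ⟨j, hj, hω⟩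
    have h1 : ∀ i ∈ S, ENNReal.ofReal (max (j i : ℝ) (q i) - q i) ≤
        ∑' k, (T i k).indicator (fun _ => ENNReal.ofReal (overlap (q i) k)) ω := fun i hi => by
      refine le_trans (le_of_eq ?_) (ENNReal.sum_le_tsum (Finset.range (j i)))
      have e := sum_overlap (q i) (j i)
      rw [max_eq_right (hq i hi)] at e
      rw [← e, ENNReal.ofReal_sum_of_nonneg fun k _ => overlap_nonneg _ _]
      refine Finset.sum_congr rfl fun k hk => ?_
      rw [Set.indicator_of_mem (subset_toMeasurable P _ (hω i hi k (Finset.mem_range.1 hk)))]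
    change _ ≤ Y ω
    refine le_trans ?_ (Finset.sum_le_sum h1)
    rw [← ENNReal.ofReal_sum_of_nonneg fun i _ => sub_nonneg.2 (le_max_right _ _)]
    refine ENNReal.ofReal_le_ofReal ?_
    rw [Finset.sum_sub_distrib]
    have h2 : ∑ i ∈ S, (j i : ℝ) ≤ ∑ i ∈ S, max (j i : ℝ) (q i) :=
      Finset.sum_le_sum fun i _ => le_max_left _ _
    linarith
  calc _ ≤ P {ω | ENNReal.ofReal b ≤ Y ω} := measure_mono hsub
    _ ≤ (∫⁻ ω, Y ω ∂P) / ENNReal.ofReal b :=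
      meas_ge_le_lintegral_div hYm.aemeasurable (by simpa using hb) ENNReal.ofReal_ne_top
    _ ≤ ENNReal.ofReal (∑ i ∈ S, F i) / ENNReal.ofReal b := by gcongr
    _ = _ := (ENNReal.ofReal_div_of_pos hb).symm

/-! ### The deterministic time -/

lemma lambertBar_spec {x : ℝ} (hx : 1 ≤ x) :
    1 ≤ lambertBar x ∧ lambertBar x - Real.log (lambertBar x) = x := by
  have h := lambertWNeg_spec (y := -Real.exp (-x))
    (neg_le_neg (Real.exp_le_exp.2 (by linarith))) (by simp [Real.exp_pos])
  have h1 : 1 ≤ lambertBar x := by rw [lambertBar]; linarith [h.1]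
  refine ⟨h1, ?_⟩
  have h2 : lambertBar x * Real.exp (-lambertBar x) = Real.exp (-x) := by
    have := h.2.1
    rw [lambertBar, neg_neg]
    linarith
  have h3 := congrArg Real.log h2
  rw [Real.log_mul (by positivity) (by positivity), Real.log_exp, Real.log_exp] at h3
  linarith

lemma one_le_div_add_log {A B : ℝ} (hA : 0 < A) (hB : 1 ≤ B) : 1 ≤ B / A + Real.log A := by
  have h1 := Real.log_le_sub_one_of_pos (inv_pos.2 hA)
  rw [Real.log_inv] at h1
  have h2 : A⁻¹ ≤ B / A := by rw [div_eq_mul_inv]; nlinarith [inv_pos.2 hA]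
  linarith

/-- `h₂` solves `u = A * log (u / δ) + B`; here `c = log (u / δ)`. -/
lemma h₂_spec {A B δ : ℝ} (hA : 0 < A) (hB : 1 ≤ B) (hδ : 0 < δ) (hδ1 : δ < 1) :
    ∃ c : ℝ, 0 ≤ c ∧ h₂ (Real.log (1 / δ)) A B = A * c + B ∧
      A ≤ h₂ (Real.log (1 / δ)) A B ∧
      h₂ (Real.log (1 / δ)) A B * Real.exp (-c) = δ := by
  have hl : 0 < Real.log (1 / δ) := Real.log_pos (by rw [lt_div_iff₀ hδ]; linarith)
  have hx : 1 ≤ Real.log (1 / δ) + B / A + Real.log A := by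
    linarith [one_le_div_add_log hA hB]
  obtain ⟨h1, h2⟩ := lambertBar_spec hx
  rw [h₂]
  set w := lambertBar (Real.log (1 / δ) + B / A + Real.log A)
  have hw : 0 < w := by linarith
  have hAw : A ≤ A * w := by nlinarith
  have hU : A * w = A * (w - B / A) + B := by field_simp; ring
  have hc : w - B / A = Real.log (A * w) + Real.log (1 / δ) := by
    rw [Real.log_mul hA.ne' hw.ne']; linarith
  refine ⟨w - B / A, ?_, hU, hAw, ?_⟩
  · rw [hc]
    -- If c < 0 then U = Aw < 1. From log(1/U) ≤ 1/U − 1 and A ≤ U follows A log U ≥ U − 1, hence U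
    -- = A c + B > U − 1 + B ≥ U.
    by_contra! hneg
    have h3 : Real.log (A * w) < 0 := by linarith
    have h4 : A * w < 1 := by
      by_contra! h5
      exact absurd (Real.log_nonneg h5) (by linarith)
    have h5 := Real.log_le_sub_one_of_pos (show 0 < (A * w)⁻¹ by positivity)
    rw [Real.log_inv] at h5
    have h6 : A * (A * w)⁻¹ ≤ 1 := by
      rw [← div_eq_mul_inv, div_le_one (by positivity)]; exact hAw
    have h7 : A * -Real.log (A * w) ≤ 1 - A * w := by
      have e : A * ((A * w)⁻¹ - 1) = A * (A * w)⁻¹ * (1 - A * w) := by field_simp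
      calc A * -Real.log (A * w) ≤ A * ((A * w)⁻¹ - 1) := mul_le_mul_of_nonneg_left h5 hA.le
        _ ≤ 1 * (1 - A * w) := e ▸ mul_le_mul_of_nonneg_right h6 (by linarith)
        _ = 1 - A * w := one_mul _
    rw [hc] at hU
    nlinarith [mul_pos hA hl]
  · rw [hc, neg_add, Real.exp_add, Real.exp_neg, Real.exp_log (by positivity), one_div,
      Real.log_inv, neg_neg, Real.exp_log hδ]
    field_simp

lemma h₂_isBigO {A : ℝ} (B : ℝ) (hA : 0 < A) :
    (fun δ : ℝ => h₂ (Real.log (1 / δ)) A B - A * Real.log (1 / δ))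
      =O[𝓝[>] 0] fun δ : ℝ => Real.log (Real.log (1 / δ)) := by
  have hl : Tendsto (fun δ : ℝ => Real.log (1 / δ)) (𝓝[>] 0) atTop := by
    simp only [one_div]
    exact Real.tendsto_log_atTop.comp tendsto_inv_nhdsGT_zero
  refine Asymptotics.IsBigO.comp_tendsto (f := fun l : ℝ => h₂ l A B - A * l)
    (g := fun l : ℝ => Real.log l) ?_ hl
  set C := B / A + Real.log A with hC
  refine Asymptotics.IsBigO.of_bound (A * (3 + |C|)) ?_
  filter_upwards [eventually_ge_atTop (1 + |C|), eventually_ge_atTop (Real.exp 1),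
    eventually_ge_atTop 4] with l h1 h2 h4
  have hlog : 1 ≤ Real.log l := (Real.le_log_iff_exp_le (by linarith)).2 h2
  have hx : 1 ≤ l + B / A + Real.log A := by linarith [neg_abs_le C]
  obtain ⟨h5, h6⟩ := lambertBar_spec hx
  rw [h₂]
  set w := lambertBar (l + B / A + Real.log A)
  -- This gives w ≤ 2(l + C) ≤ 4l − 2 ≤ l², so log w is at most 2 log l.
  have hw2 : Real.log w ≤ w / 2 := by
    have := Real.log_le_sub_one_of_pos (show 0 < w / 2 by linarith)
    rw [Real.log_div (by linarith) (by norm_num)] at this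
    linarith [Real.log_two_lt_d9]
  have hw4 : w ≤ l ^ 2 := by nlinarith [le_abs_self C]
  have hlw : Real.log w ≤ 2 * Real.log l := by
    have := Real.log_le_log (by linarith) hw4
    rwa [Real.log_pow, Nat.cast_ofNat] at this
  have hlw0 : 0 ≤ Real.log w := Real.log_nonneg h5
  have e : A * w - A * l = A * (Real.log w + C) := by rw [hC]; linear_combination A * h6
  rw [e, Real.norm_eq_abs, Real.norm_eq_abs, abs_mul, abs_of_pos hA,
    abs_of_nonneg (zero_le_one.trans hlog),
    mul_assoc]
  refine mul_le_mul_of_nonneg_left ?_ hA.le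
  calc |Real.log w + C| ≤ |Real.log w| + |C| := abs_add_le _ _
    _ ≤ 2 * Real.log l + |C| * Real.log l := by
      rw [abs_of_nonneg hlw0]
      nlinarith [abs_nonneg C]
    _ ≤ _ := by nlinarith [abs_nonneg C]

/-! ### Instances without good arm -/

lemma ofReal_one_sub_le {Ω : Type*} {mΩ : MeasurableSpace Ω} {P : Measure Ω}
    [IsProbabilityMeasure P] {B G : Set Ω} {δ : ℝ} (hδ : 0 ≤ δ) (hB : P B ≤ ENNReal.ofReal δ)
    (h : ∀ᵐ ω ∂P, ω ∉ B → ω ∈ G) : ENNReal.ofReal (1 - δ) ≤ P G := by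
  have h1 : (1 : ENNReal) ≤ P (B ∪ G) := by
    rw [← measure_univ (μ := P)]
    refine measure_mono_ae ?_
    filter_upwards [h] with ω hω _
    by_cases hb : ω ∈ B
    · exact Or.inl hb
    · exact Or.inr (hω hb)
  rw [ENNReal.ofReal_sub _ hδ, ENNReal.ofReal_one, tsub_le_iff_left]
  exact h1.trans ((measure_union_le B G).trans (add_le_add hB le_rfl))

lemma sum_numPulls_cast {K : ℕ} (arm : ℕ → Fin K) (t : ℕ) :
    ∑ a, (numPulls arm a t : ℝ) = t := by
  exact_mod_cast sum_numPulls t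

lemma FollowsAPGAI.exists_pull {K : ℕ} {θ : ℝ} {arm : ℕ → Fin K} {reward : ℕ → ℝ} {n₀ : ℕ}
    {guess : ℕ → Option (Fin K)} (h : FollowsAPGAI n₀ θ arm reward guess) {a : Fin K} {k t : ℕ}
    (hk : n₀ ≤ k) (hkt : k < numPulls arm a t) :
    ∃ s < t, n₀ * K ≤ s ∧ numPulls arm a s = k ∧ arm (s + 1) = a := by
  obtain ⟨s, hst, hs, ha⟩ := GoodArm.exists_pull hkt
  refine ⟨s, hst, ?_, hs, ha⟩
  by_contra! hlt
  have h1 := numPulls_mono (arm := arm) a (show s + 1 ≤ n₀ * K from hlt)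
  rw [h.1 a, numPulls_succ, if_pos ha] at h1
  omega

lemma gap_inv_mul {x θ : ℝ} (h : x ≠ θ) : (|x - θ| ^ 2)⁻¹ * (θ - x) ^ 2 = 1 := by
  have : (θ - x) ^ 2 ≠ 0 := pow_ne_zero _ (sub_ne_zero.2 h.symm)
  rw [sq_abs, ← neg_sub θ x, neg_sq, inv_mul_cancel₀ this]

lemma gap_inv_pos {x θ : ℝ} (h : x ≠ θ) : 0 < (|x - θ| ^ 2)⁻¹ :=
  inv_pos.2 (pow_pos (abs_pos.2 (sub_ne_zero.2 h)) 2)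

lemma gap_inv_eq {x θ : ℝ} : (|x - θ| ^ 2)⁻¹ = 1 / (θ - x) ^ 2 := by
  rw [sq_abs, ← neg_sub θ x, neg_sq, one_div]

section NoGoodArm

variable {Ω : Type*} {mΩ : MeasurableSpace Ω} {K : ℕ} {P : Measure Ω} [IsProbabilityMeasure P]
  {ν : Fin K → Measure ℝ} {μ : Fin K → ℝ} {ℱ : Filtration ℕ mΩ} {arm : ℕ → Ω → Fin K}
  {reward : ℕ → Ω → ℝ} {guess : ℕ → Ω → Option (Fin K)} {θ : ℝ} {n₀ : ℕ}

lemma IsBanditProcess.measure_exists_return_le (h : IsBanditProcess P ν ℱ arm reward)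
    (hν : ∀ a, IsOneSubGaussian (ν a) (μ a)) {a : Fin K} (ha : μ a < θ) {w : ℝ} (hw : 0 ≤ w) :
    P (⋃ n : ℕ, {ω | ∃ s t, s ≤ t ∧ pulls arm a s ω = n + 1 ∧ stat θ arm reward a s ω ≤ -w ∧
        0 ≤ stat θ arm reward a t ω}) ≤
      ENNReal.ofReal (2 * (|μ a - θ| ^ 2)⁻¹ * Real.exp (-(w ^ 2 / 2))) := by
  have hd : 0 < (θ - μ a) ^ 2 := pow_pos (sub_pos.2 ha) 2
  refine (measure_iUnion_le _).trans ?_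
  calc _ ≤ ∑' n : ℕ, ENNReal.ofReal (Real.exp (-(w ^ 2 / 2))) *
        ENNReal.ofReal (Real.exp (-((θ - μ a) ^ 2 / 2 * (n + 1)))) := by
        refine ENNReal.tsum_le_tsum fun n =>
          (h.measure_return_le hν ha n.succ_pos hw).trans_eq ?_
        rw [← ENNReal.ofReal_mul (Real.exp_pos _).le, ← Real.exp_add]
        push_cast
        ring_nf
    _ ≤ ENNReal.ofReal (Real.exp (-(w ^ 2 / 2))) *
        ENNReal.ofReal (1 / ((θ - μ a) ^ 2 / 2)) := by
        rw [ENNReal.tsum_mul_left]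
        gcongr
        exact tsum_exp_le (by positivity)
    _ = _ := by
        rw [← ENNReal.ofReal_mul (Real.exp_pos _).le, gap_inv_eq]
        congr 1
        field_simp

theorem IsBanditProcess.empty_of_one_lt (h : IsBanditProcess P ν ℱ arm reward)
    (hν : ∀ a, IsOneSubGaussian (ν a) (μ a)) (hμ : ∀ a, μ a < θ) (hK : 2 ≤ K) (hn₀ : 0 < n₀)
    (halg : ∀ᵐ ω ∂P, FollowsAPGAI n₀ θ (fun t => arm t ω) (fun t => reward t ω)
      (fun t => guess t ω)) {δ : ℝ} (hδ : 0 < δ) (hδ1 : δ < 1) :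
    ENNReal.ofReal (1 - δ) ≤ P {ω | ∀ t : ℕ,
      h₂ (Real.log (1 / δ)) (18 * H₁ θ μ) (n₀ * K) < t → guess t ω = none} := by
  have hH : 0 < H₁ θ μ :=
    Finset.sum_pos (fun a _ => gap_inv_pos (hμ a).ne) ⟨⟨0, by omega⟩, Finset.mem_univ _⟩
  have hKB : (2 : ℝ) ≤ K := by exact_mod_cast hK
  have hnB : (1 : ℝ) ≤ n₀ := by exact_mod_cast hn₀
  have hKn : (K : ℝ) ≤ n₀ * K := le_mul_of_one_le_left (by linarith) hnB
  obtain ⟨c, hc0, hU, hAU, hUδ⟩ :=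
    h₂_spec (A := 18 * H₁ θ μ) (B := n₀ * K) (by positivity) (by linarith) hδ hδ1
  set U := h₂ (Real.log (1 / δ)) (18 * H₁ θ μ) (n₀ * K)
  have hUK : n₀ * K ≤ U := by nlinarith
  -- Chosen so that 18c = 4w²: after 18c/Δ_b² pulls the statistic of b has drifted to about −2w or
  -- below, and staying above −w costs e^{-w²/2}, as does the return.
  set w := √(9 * c / 2) with hw
  have hw0 : 0 ≤ w := Real.sqrt_nonneg _
  have hww : w ^ 2 = 9 * c / 2 := Real.sq_sqrt (by positivity)
  let m : Fin K → ℕ := fun b => max n₀ ⌈18 * c * (|μ b - θ| ^ 2)⁻¹⌉₊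
  let B₁ : Set Ω := ⋃ b, {ω | ∃ t, pulls arm b t ω = m b ∧ -w ≤ stat θ arm reward b t ω}
  let B₂ : Set Ω := ⋃ a, ⋃ n : ℕ, {ω | ∃ s t, s ≤ t ∧ pulls arm a s ω = n + 1 ∧
    stat θ arm reward a s ω ≤ -w ∧ 0 ≤ stat θ arm reward a t ω}
  refine ofReal_one_sub_le (B := B₁ ∪ B₂) hδ.le ?_ ?_
  · have hB₁ : P B₁ ≤ ENNReal.ofReal (K * Real.exp (-(w ^ 2 / 2))) := by
      refine (measure_iUnion_fintype_le _ _).trans ?_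
      rw [ENNReal.ofReal_mul (by positivity), ENNReal.ofReal_natCast]
      refine (Finset.sum_le_card_nsmul _ _ _ fun b _ => ?_).trans_eq
        (by rw [Finset.card_univ, Fintype.card_fin, nsmul_eq_mul])
      have hd : 0 < θ - μ b := sub_pos.2 (hμ b)
      have hm : 18 * c * (|μ b - θ| ^ 2)⁻¹ ≤ m b :=
        (Nat.le_ceil _).trans (by exact_mod_cast le_max_right _ _)
      have h2w : 2 * w ≤ (θ - μ b) * √(m b) := by
        refine le_of_sq_le_sq ?_ (by positivity)
        rw [mul_pow, mul_pow, Real.sq_sqrt (Nat.cast_nonneg (m b)), hww]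
        have := mul_le_mul_of_nonneg_right hm (sq_nonneg (θ - μ b))
        rw [mul_assoc, gap_inv_mul (hμ b).ne] at this
        linarith
      refine (h.measure_near_le hν b (hn₀.trans_le (le_max_left _ _)) (by linarith)).trans ?_
      refine ENNReal.ofReal_le_ofReal (Real.exp_le_exp.2 (neg_le_neg ?_))
      nlinarith
    have hB₂ : P B₂ ≤ ENNReal.ofReal (2 * H₁ θ μ * Real.exp (-(w ^ 2 / 2))) := by
      refine (measure_iUnion_fintype_le _ _).trans ?_
      rw [H₁, Finset.mul_sum, Finset.sum_mul, ENNReal.ofReal_sum_of_nonneg fun a _ => by positivity]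
      exact Finset.sum_le_sum fun a _ => h.measure_exists_return_le hν (hμ a) hw0
    refine (measure_union_le _ _).trans ((add_le_add hB₁ hB₂).trans ?_)
    rw [← ENNReal.ofReal_add (by positivity) (by positivity)]
    refine ENNReal.ofReal_le_ofReal ?_
    -- Here w²/2 = 9c/4 ≥ 2c, and U ≥ 2 with U e^{-c} < 1 gives e^{-c} ≤ 1/2; this is where K ≥ 2 is
    -- used.
    have he : Real.exp (-(w ^ 2 / 2)) ≤ Real.exp (-c) * (1 / 2) := by
      have h1 : Real.exp (-(w ^ 2 / 2)) ≤ Real.exp (-c) * Real.exp (-c) := by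
        rw [← Real.exp_add]
        exact Real.exp_le_exp.2 (by rw [hww]; linarith)
      have h2 : Real.exp (-c) ≤ 1 / 2 := by
        have := Real.exp_pos (-c)
        nlinarith
      exact h1.trans (mul_le_mul_of_nonneg_left h2 (Real.exp_pos _).le)
    have h3 : (K + 2 * H₁ θ μ) * (1 / 2) ≤ U := by linarith
    calc _ = (K + 2 * H₁ θ μ) * Real.exp (-(w ^ 2 / 2)) := by ring
      _ ≤ (K + 2 * H₁ θ μ) * (Real.exp (-c) * (1 / 2)) :=
        mul_le_mul_of_nonneg_left he (by positivity)
      _ = (K + 2 * H₁ θ μ) * (1 / 2) * Real.exp (-c) := by ring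
      _ ≤ U * Real.exp (-c) := mul_le_mul_of_nonneg_right h3 (Real.exp_pos _).le
      _ = δ := hUδ
  · filter_upwards [halg] with ω hω hB t ht
    have ht0 : n₀ * K ≤ t := by exact_mod_cast (hUK.trans ht.le)
    rcases hω.guess_spec hn₀ ht0 with hg | ⟨-, hpos⟩
    · exact hg.1
    exfalso
    apply hB
    set a := arm (t + 1) ω with ha
    obtain ⟨b, -, hb⟩ : ∃ b ∈ Finset.univ, (n₀ : ℝ) + 18 * c * (|μ b - θ| ^ 2)⁻¹ <
        (numPulls (fun t => arm t ω) b t : ℝ) := by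
      refine Finset.exists_lt_of_sum_lt ?_
      rw [Finset.sum_add_distrib, ← Finset.mul_sum, sum_numPulls_cast,
        Finset.sum_const, Finset.card_univ, Fintype.card_fin, nsmul_eq_mul]
      change _ + 18 * c * H₁ θ μ < _
      linarith
    have hh : 0 ≤ 18 * c * (|μ b - θ| ^ 2)⁻¹ := by positivity
    -- The summand n₀ ≥ 1 absorbs the rounding in the ceiling.
    have hmb : m b < numPulls (fun t => arm t ω) b t := by
      refine max_lt ?_ ?_
      · exact_mod_cast (show (n₀ : ℝ) < (numPulls (fun t => arm t ω) b t : ℝ) by linarith)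
      · have := Nat.ceil_lt_add_one hh
        exact_mod_cast (show (⌈18 * c * (|μ b - θ| ^ 2)⁻¹⌉₊ : ℝ) <
          (numPulls (fun t => arm t ω) b t : ℝ) by linarith)
    obtain ⟨s, hst, hs0, hs, hsb⟩ := hω.exists_pull (le_max_left _ _) hmb
    have hle := hω.signedStat_le hn₀ hs0 a
    rw [hsb] at hle
    by_cases hnear : -w ≤ stat θ arm reward b s ω
    · exact Or.inl (Set.mem_iUnion.2 ⟨b, s, hs, hnear⟩)
    · refine Or.inr (Set.mem_iUnion.2 ⟨a, Set.mem_iUnion.2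
        ⟨numPulls (fun t => arm t ω) a s - 1, s, t, hst.le, ?_, ?_, hpos.le⟩⟩)
      · have := hω.le_numPulls a hs0
        change numPulls _ _ _ = _
        omega
      · exact hle.trans (not_le.1 hnear).le

/-- With one arm U ≥ 2 may fail, but the pull count equals t, so a single bound for a nonnegative
statistic after more than U pulls suffices. -/
theorem IsBanditProcess.empty_of_one {μ : Fin 1 → ℝ} {ν : Fin 1 → Measure ℝ}
    {arm : ℕ → Ω → Fin 1} {guess : ℕ → Ω → Option (Fin 1)}
    (h : IsBanditProcess P ν ℱ arm reward)
    (hν : ∀ a, IsOneSubGaussian (ν a) (μ a)) (hμ : ∀ a, μ a < θ) (hn₀ : 0 < n₀)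
    (halg : ∀ᵐ ω ∂P, FollowsAPGAI n₀ θ (fun t => arm t ω) (fun t => reward t ω)
      (fun t => guess t ω)) {δ : ℝ} (hδ : 0 < δ) (hδ1 : δ < 1) :
    ENNReal.ofReal (1 - δ) ≤ P {ω | ∀ t : ℕ,
      h₂ (Real.log (1 / δ)) (18 * H₁ θ μ) (n₀ * (1 : ℕ)) < t → guess t ω = none} := by
  have hH₁ : H₁ θ μ = (|μ 0 - θ| ^ 2)⁻¹ := by rw [H₁, Fin.sum_univ_one]
  have hH : 0 < H₁ θ μ := hH₁ ▸ gap_inv_pos (hμ 0).ne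
  have hHd : H₁ θ μ * (θ - μ 0) ^ 2 = 1 := hH₁ ▸ gap_inv_mul (hμ 0).ne
  have hnB : (1 : ℝ) ≤ n₀ * (1 : ℕ) := by
    rw [Nat.cast_one, mul_one]
    exact_mod_cast hn₀
  obtain ⟨c, hc0, hU, hAU, hUδ⟩ :=
    h₂_spec (A := 18 * H₁ θ μ) (B := n₀ * (1 : ℕ)) (by positivity) hnB hδ hδ1
  set U := h₂ (Real.log (1 / δ)) (18 * H₁ θ μ) (n₀ * (1 : ℕ))
  have hHc : 0 ≤ 18 * H₁ θ μ * c := by positivity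
  refine ofReal_one_sub_le (B := {ω | ∃ t, ⌊U⌋₊ + 1 ≤ pulls arm 0 t ω ∧
    0 ≤ stat θ arm reward 0 t ω}) hδ.le ?_ ?_
  · refine (h.measure_nonneg_le hν (hμ 0) (Nat.succ_pos _)).trans (ENNReal.ofReal_le_ofReal ?_)
    have h1 : U ≤ ((⌊U⌋₊ + 1 : ℕ) : ℝ) := by
      push_cast
      exact (Nat.lt_floor_add_one U).le
    have h2 := mul_le_mul_of_nonneg_left h1 (sq_nonneg (θ - μ 0))
    have h3 : (θ - μ 0) ^ 2 * (18 * H₁ θ μ * c) = 18 * c := by linear_combination 18 * c * hHd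
    have h4 : 18 * c ≤ (θ - μ 0) ^ 2 * U := by
      rw [hU, mul_add, h3]
      have := mul_nonneg (sq_nonneg (θ - μ 0)) (zero_le_one.trans hnB)
      linarith
    calc _ ≤ Real.exp (-c) := Real.exp_le_exp.2 (by linarith)
      _ ≤ U * Real.exp (-c) := le_mul_of_one_le_left (Real.exp_pos _).le (by linarith)
      _ = δ := hUδ
  · filter_upwards [halg] with ω hω hB t ht
    have ht0 : n₀ * 1 ≤ t := by exact_mod_cast (show (n₀ * (1 : ℕ) : ℝ) ≤ t by linarith)
    rcases hω.guess_spec hn₀ ht0 with hg | ⟨-, hpos⟩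
    · exact hg.1
    refine absurd ⟨t, ?_, ?_⟩ hB
    · have := sum_numPulls (arm := fun t => arm t ω) t
      rw [Fin.sum_univ_one] at this
      change _ ≤ numPulls _ _ _
      rw [this]
      exact (Nat.floor_lt (by linarith)).2 ht
    · rw [Subsingleton.elim (arm (t + 1) ω) 0] at hpos
      exact hpos.le

end NoGoodArm

/-! ### Numerical estimates -/

lemma exp_le_of_pow_le {x y : ℝ} (p q : ℕ) (hq : q ≠ 0) (hx : q * x = p) (hy : 0 ≤ y)
    (h : (2.7182818286 : ℝ) ^ p ≤ y ^ q) : Real.exp x ≤ y := by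
  refine le_of_pow_le_pow_left₀ hq hy ?_
  rw [← Real.exp_nat_mul, hx, ← mul_one (p : ℝ), Real.exp_nat_mul]
  exact (pow_le_pow_left₀ (Real.exp_pos 1).le Real.exp_one_lt_d9.le p).trans h

lemma one_sided_bound_of_mem {H c l u E : ℝ} (hH : 0 ≤ H) (hl : l ≤ c) (hu : c ≤ u)
    (hE : Real.exp u ≤ E) (h : 4 * H * c + 4 ≤ Real.exp c) (hl0 : 0 < l) (hl1 : l ≤ 3.05)
    (hlE : (12.2 - 4 * l) * (E - 4) ≤ 3.07 * (4 * l)) : 12.2 * H ≤ 4 * H * c + 3.07 := by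
  have h1 : 4 * l * H ≤ E - 4 := by
    nlinarith [mul_nonneg hH (sub_nonneg.2 hl), Real.exp_le_exp.2 hu]
  have h2 : (12.2 - 4 * l) * H ≤ 3.07 := by
    have h3 := mul_le_mul_of_nonneg_left h1 (show 0 ≤ 12.2 - 4 * l by linarith)
    have h4 : (4 * l) * ((12.2 - 4 * l) * H) ≤ (4 * l) * 3.07 := by linarith
    exact le_of_mul_le_mul_left h4 (by linarith)
  nlinarith [mul_nonneg hH (sub_nonneg.2 hl)]

/-- For c ≥ 3.05 the left side is already at most 4Hc. Below that, H ≤ (e^c − 4)/(4c), and (12.2 −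
4c)(e^c − 4)/(4c) ≤ 3.07 is checked on five intervals by endpoint bounds. -/
lemma gap_sum_bound {H c : ℝ} (hH : 0 ≤ H) (hc : 1.386 ≤ c) (h : 4 * H * c + 4 ≤ Real.exp c) :
    12.2 * H ≤ 4 * H * c + 3.07 := by
  rcases le_total c 1.8 with h1 | h1
  · exact one_sided_bound_of_mem (E := 6.05) hH hc h1
      (exp_le_of_pow_le 9 5 (by norm_num) (by norm_num) (by norm_num) (by norm_num)) h
      (by norm_num) (by norm_num) (by norm_num)
  rcases le_total c 2.1 with h2 | h2
  · exact one_sided_bound_of_mem (E := 8.17) hH h1 h2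
      (exp_le_of_pow_le 21 10 (by norm_num) (by norm_num) (by norm_num) (by norm_num)) h
      (by norm_num) (by norm_num) (by norm_num)
  rcases le_total c 2.35 with h3 | h3
  · exact one_sided_bound_of_mem (E := 10.49) hH h2 h3
      (exp_le_of_pow_le 47 20 (by norm_num) (by norm_num) (by norm_num) (by norm_num)) h
      (by norm_num) (by norm_num) (by norm_num)
  rcases le_total c 2.6 with h4 | h4
  · exact one_sided_bound_of_mem (E := 13.47) hH h3 h4
      (exp_le_of_pow_le 13 5 (by norm_num) (by norm_num) (by norm_num) (by norm_num)) h
      (by norm_num) (by norm_num) (by norm_num)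
  rcases le_total c 3.05 with h5 | h5
  · exact one_sided_bound_of_mem (E := 21.2) hH h4 h5
      (exp_le_of_pow_le 61 20 (by norm_num) (by norm_num) (by norm_num) (by norm_num)) h
      (by norm_num) (by norm_num) (by norm_num)
  · nlinarith [mul_nonneg hH (sub_nonneg.2 h5)]

lemma one_le_of_three_le_exp {c : ℝ} (h : 3 ≤ Real.exp c) : 1 ≤ c := by
  by_contra! hc
  linarith [Real.exp_le_exp.2 hc.le, Real.exp_one_lt_d9]

lemma half_exp_neg_le {c U : ℝ} (hU : 3 ≤ U) (hUc : U ≤ Real.exp c) :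
    Real.exp (-(2 * (c - 1))) / 2 ≤ U * Real.exp (-c) := by
  have e : Real.exp (-(2 * (c - 1))) =
      Real.exp (-c) * (Real.exp 1 * Real.exp 1 * Real.exp (-c)) := by
    rw [← Real.exp_add, ← Real.exp_add, ← Real.exp_add]
    ring_nf
  have h1 : 3 * Real.exp (-c) ≤ 1 := by
    rw [Real.exp_neg, ← div_eq_mul_inv, div_le_one (Real.exp_pos c)]
    linarith
  have h2 : Real.exp 1 * Real.exp 1 ≤ 9 := by
    nlinarith [Real.exp_one_lt_d9, Real.exp_pos 1]
  rw [e]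
  nlinarith [Real.exp_pos (-c), mul_le_mul_of_nonneg_right h2 (Real.exp_pos (-c)).le]

/-- After division by e^{-c} the terms are at most 0.93, 1.32 Hb, 10.88 Hb and 10.88 h. Since 10.88
+ 1.32 = 12.2 and 4 − 0.93 = 3.07, `gap_sum_bound` closes the estimate. -/
lemma total_error_le {Hg Hb h c U : ℝ} (hHb : 0 ≤ Hb) (hh0 : 0 ≤ h) (hh : h ≤ Hg)
    (hU : 4 * (Hg + Hb) * c + 4 ≤ U) (hUc : U ≤ Real.exp c) (hc0 : 0 ≤ c) :
    Real.exp (-(2 * (c - 1))) / 2 + 16 / 9 * Hb * Real.exp (-(9 / 2 * (c - 1))) +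
      4 * Hb * Real.exp (-(c - 1)) + 4 * h * Real.exp (-(c - 1)) ≤ U * Real.exp (-c) := by
  have hH : 0 ≤ Hg + Hb := by linarith
  have h4 : 4 ≤ Real.exp c := by nlinarith [mul_nonneg hH hc0]
  have hc : 1.386 ≤ c := by
    have h1 : Real.log 4 ≤ c := (Real.log_le_iff_le_exp (by norm_num)).2 h4
    have h2 : Real.log 4 = 2 * Real.log 2 := by
      rw [show (4 : ℝ) = 2 ^ 2 by norm_num, Real.log_pow]
      norm_num
    linarith [Real.log_two_gt_d9]
  have hg := gap_sum_bound hH hc (hU.trans hUc)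
  have e1 : Real.exp (-(2 * (c - 1))) =
      Real.exp (-c) * (Real.exp 1 * Real.exp 1 * Real.exp (-c)) := by
    rw [← Real.exp_add, ← Real.exp_add, ← Real.exp_add]
    ring_nf
  have e2 : Real.exp (-(9 / 2 * (c - 1))) = Real.exp (-c) * Real.exp (9 / 2 - 7 / 2 * c) := by
    rw [← Real.exp_add]
    ring_nf
  have e3 : Real.exp (-(c - 1)) = Real.exp (-c) * Real.exp 1 := by
    rw [← Real.exp_add]
    ring_nf
  have b1 : Real.exp 1 * Real.exp 1 * Real.exp (-c) / 2 ≤ 0.93 := by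
    have h1 : 4 * Real.exp (-c) ≤ 1 := by
      rw [Real.exp_neg, ← div_eq_mul_inv, div_le_one (Real.exp_pos c)]
      exact h4
    have h2 : Real.exp 1 * Real.exp 1 ≤ 7.4 := by
      nlinarith [Real.exp_one_lt_d9, Real.exp_pos 1]
    nlinarith [Real.exp_pos (-c), mul_le_mul_of_nonneg_right h2 (Real.exp_pos (-c)).le]
  have b2 : 16 / 9 * Real.exp (9 / 2 - 7 / 2 * c) ≤ 1.32 := by
    have h1 : Real.exp (9 / 2 - 7 / 2 * c) ≤ Real.exp (-0.35) :=
      Real.exp_le_exp.2 (by linarith)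
    have h2 : Real.exp (-0.35) * Real.exp 0.35 = 1 := by rw [← Real.exp_add]; norm_num
    have h3 := Real.add_one_le_exp (0.35 : ℝ)
    nlinarith [Real.exp_pos (-0.35 : ℝ)]
  have b3 : 4 * Real.exp 1 ≤ 10.88 := by linarith [Real.exp_one_lt_d9]
  have key : Real.exp 1 * Real.exp 1 * Real.exp (-c) / 2 +
      16 / 9 * Hb * Real.exp (9 / 2 - 7 / 2 * c) + 4 * Hb * Real.exp 1 +
      4 * h * Real.exp 1 ≤ U := by
    have k1 := mul_le_mul_of_nonneg_right b2 hHb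
    have k2 := mul_le_mul_of_nonneg_right b3 (add_nonneg hHb hh0)
    linarith
  rw [e1, e2, e3]
  calc _ = (Real.exp 1 * Real.exp 1 * Real.exp (-c) / 2 +
      16 / 9 * Hb * Real.exp (9 / 2 - 7 / 2 * c) + 4 * Hb * Real.exp 1 +
      4 * h * Real.exp 1) * Real.exp (-c) := by ring
    _ ≤ _ := mul_le_mul_of_nonneg_right key (Real.exp_pos _).le

/-! ### Instances with a good arm -/

section GoodArmExists

variable {Ω : Type*} {mΩ : MeasurableSpace Ω} {K : ℕ} {P : Measure Ω} [IsProbabilityMeasure P]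
  {ν : Fin K → Measure ℝ} {μ : Fin K → ℝ} {ℱ : Filtration ℕ mΩ} {arm : ℕ → Ω → Fin K}
  {reward : ℕ → Ω → ℝ} {guess : ℕ → Ω → Option (Fin K)} {θ : ℝ} {n₀ : ℕ}

lemma tsum_overlap_mul_le {f : ℕ → ENNReal} {C r q : ℝ} (hC : 0 ≤ C) (hr : 0 < r) (hq : 0 ≤ q)
    (hf : ∀ k : ℕ, f k ≤ ENNReal.ofReal (C * Real.exp (-(r * (k + 1))))) :
    ∑' k, ENNReal.ofReal (overlap q k) * f k ≤
      ENNReal.ofReal (C * (Real.exp (-(r * q)) / r)) := by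
  calc _ ≤ ∑' k : ℕ, ENNReal.ofReal C *
        ENNReal.ofReal (overlap q k * Real.exp (-(r * (k + 1)))) := by
        refine ENNReal.tsum_le_tsum fun k => (mul_le_mul_right (hf k) _).trans_eq ?_
        rw [← ENNReal.ofReal_mul (overlap_nonneg q k), ← ENNReal.ofReal_mul hC]
        ring_nf
    _ ≤ _ := by
        rw [ENNReal.tsum_mul_left, ENNReal.ofReal_mul hC]
        gcongr
        exact tsum_overlap_le hr hq

lemma tsum_exp_mul_le {x d s : ℝ} (hd : 0 < d) (hs : 0 < s) :
    ∑' n : ℕ, ENNReal.ofReal (Real.exp (-(x + d ^ 2 * ((n + 1 : ℕ) : ℝ) / s))) ≤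
      ENNReal.ofReal (s * (1 / d ^ 2) * Real.exp (-x)) := by
  calc _ = ∑' n : ℕ, ENNReal.ofReal (Real.exp (-x)) *
        ENNReal.ofReal (Real.exp (-(d ^ 2 / s * (n + 1)))) := by
        refine tsum_congr fun n => ?_
        rw [← ENNReal.ofReal_mul (Real.exp_pos _).le, ← Real.exp_add]
        push_cast
        ring_nf
    _ ≤ ENNReal.ofReal (Real.exp (-x)) * ENNReal.ofReal (1 / (d ^ 2 / s)) := by
        rw [ENNReal.tsum_mul_left]
        gcongr
        exact tsum_exp_le (by positivity)
    _ = _ := by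
        rw [← ENNReal.ofReal_mul (Real.exp_pos _).le]
        congr 1
        field_simp

/-- Arm `a` has exactly `n₀ + k` pulls at a time when its statistic is at least that of `b`. -/
def preferredTo (θ : ℝ) (arm : ℕ → Ω → Fin K) (reward : ℕ → Ω → ℝ) (n₀ : ℕ) (b a : Fin K)
    (k : ℕ) : Set Ω :=
  ⋃ n : ℕ, {ω | ∃ t, pulls arm a t ω = n₀ + k ∧ pulls arm b t ω = n + 1 ∧
    stat θ arm reward b t ω ≤ stat θ arm reward a t ω}

/-- Arm `b` has at least `k + 1` pulls at a time when its statistic is nonpositive or at most the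
nonnegative statistic of an arm in `S`. -/
def dominatedBy (θ : ℝ) (arm : ℕ → Ω → Fin K) (reward : ℕ → Ω → ℝ) (S : Finset (Fin K))
    (b : Fin K) (k : ℕ) : Set Ω :=
  {ω | ∃ t, k + 1 ≤ pulls arm b t ω ∧ stat θ arm reward b t ω ≤ 0} ∪
  ⋃ a ∈ S, ⋃ n : ℕ, {ω | ∃ t, pulls arm a t ω = n + 1 ∧ k + 1 ≤ pulls arm b t ω ∧
    0 ≤ stat θ arm reward a t ω ∧ stat θ arm reward b t ω ≤ stat θ arm reward a t ω}

lemma IsBanditProcess.measure_preferredTo_le (h : IsBanditProcess P ν ℱ arm reward)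
    (hν : ∀ a, IsOneSubGaussian (ν a) (μ a)) {a b : Fin K} (ha : μ a < θ) (hb : θ < μ b)
    (hn₀ : 0 < n₀) (k : ℕ) :
    P (preferredTo θ arm reward n₀ b a k) ≤ ENNReal.ofReal
      (4 * (|μ b - θ| ^ 2)⁻¹ * Real.exp (-((θ - μ a) ^ 2 / 4 * (k + 1)))) := by
  have hd : 0 < μ b - θ := sub_pos.2 hb
  refine (measure_iUnion_le _).trans ?_
  have h1 : ∀ n : ℕ, P {ω | ∃ t, pulls arm a t ω = n₀ + k ∧ pulls arm b t ω = n + 1 ∧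
      stat θ arm reward b t ω ≤ stat θ arm reward a t ω} ≤ ENNReal.ofReal (Real.exp
        (-((θ - μ a) ^ 2 / 4 * (k + 1) + (μ b - θ) ^ 2 * ((n + 1 : ℕ) : ℝ) / 4))) := fun n => by
    refine (h.measure_pair_le hν ha hb (by omega) n.succ_pos).trans
      (ENNReal.ofReal_le_ofReal (Real.exp_le_exp.2 (neg_le_neg ?_)))
    have hk : (k : ℝ) + 1 ≤ (n₀ + k : ℕ) := by exact_mod_cast (by omega : k + 1 ≤ n₀ + k)
    have := mul_le_mul_of_nonneg_left hk (sq_nonneg (θ - μ a))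
    linarith
  refine (ENNReal.tsum_le_tsum h1).trans ((tsum_exp_mul_le hd (by norm_num)).trans_eq ?_)
  rw [gap_inv_eq, ← neg_sub θ (μ b), neg_sq]

lemma IsBanditProcess.measure_dominatedBy_le (h : IsBanditProcess P ν ℱ arm reward)
    (hν : ∀ a, IsOneSubGaussian (ν a) (μ a)) {S : Finset (Fin K)} (hS : ∀ a ∈ S, μ a < θ)
    {b : Fin K} (hb : θ < μ b) (k : ℕ) :
    P (dominatedBy θ arm reward S b k) ≤
      ENNReal.ofReal (1 * Real.exp (-((θ - μ b) ^ 2 / 2 * (k + 1)))) +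
      (ENNReal.ofReal (8 * (∑ a ∈ S, (|μ a - θ| ^ 2)⁻¹) *
        Real.exp (-(9 * (θ - μ b) ^ 2 / 8 * (k + 1)))) +
      ENNReal.ofReal (4 * (∑ a ∈ S, (|μ a - θ| ^ 2)⁻¹) *
        Real.exp (-((θ - μ b) ^ 2 / 4 * (k + 1))))) := by
  refine (measure_union_le _ _).trans (add_le_add ?_ ?_)
  · refine (h.measure_nonpos_le hν hb k.succ_pos).trans_eq ?_
    push_cast
    ring_nf
  refine (measure_biUnion_finset_le _ _).trans ?_
  rw [Finset.mul_sum, Finset.mul_sum, Finset.sum_mul, Finset.sum_mul,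
    ENNReal.ofReal_sum_of_nonneg fun a _ => by positivity,
    ENNReal.ofReal_sum_of_nonneg fun a _ => by positivity, ← Finset.sum_add_distrib]
  refine Finset.sum_le_sum fun a ha => (measure_iUnion_le _).trans ?_
  have hd : 0 < θ - μ a := sub_pos.2 (hS a ha)
  refine (ENNReal.tsum_le_tsum fun n : ℕ =>
    h.measure_pair_tail_le hν (hS a ha) hb k.succ_pos n.succ_pos).trans ?_
  rw [ENNReal.tsum_add, gap_inv_eq]
  have e1 : ∀ n : ℕ, (9 * ((θ - μ b) ^ 2 * ((k + 1 : ℕ) : ℝ)) +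
      (θ - μ a) ^ 2 * ((n + 1 : ℕ) : ℝ)) / 8 =
      9 * (θ - μ b) ^ 2 / 8 * (k + 1) + (θ - μ a) ^ 2 * ((n + 1 : ℕ) : ℝ) / 8 := fun n => by
    push_cast
    ring
  have e2 : ∀ n : ℕ, ((θ - μ b) ^ 2 * ((k + 1 : ℕ) : ℝ) +
      (θ - μ a) ^ 2 * ((n + 1 : ℕ) : ℝ)) / 4 =
      (θ - μ b) ^ 2 / 4 * (k + 1) + (θ - μ a) ^ 2 * ((n + 1 : ℕ) : ℝ) / 4 := fun n => by
    push_cast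
    ring
  simp only [e1, e2]
  exact add_le_add (tsum_exp_mul_le hd (by norm_num)) (tsum_exp_mul_le hd (by norm_num))

/-- The cutoff 4κ/Δ_a² makes the decay at rate Δ_a²/4 equal to e^{-κ} for every arm. The expected
excess is then proportional to the sum of Δ_a⁻², which the Markov denominator cancels. -/
lemma IsBanditProcess.measure_excess_bad_le (h : IsBanditProcess P ν ℱ arm reward)
    (hν : ∀ a, IsOneSubGaussian (ν a) (μ a)) {S : Finset (Fin K)} (hS : ∀ a ∈ S, μ a < θ)
    (hSne : S.Nonempty) {b : Fin K} (hb : θ < μ b) (hn₀ : 0 < n₀) {κ : ℝ} (hκ : 0 ≤ κ) :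
    P {ω | ∃ j : Fin K → ℕ, 4 * ∑ a ∈ S, (|μ a - θ| ^ 2)⁻¹ +
        ∑ a ∈ S, 4 * κ * (|μ a - θ| ^ 2)⁻¹ < ∑ a ∈ S, (j a : ℝ) ∧
        ∀ a ∈ S, ∀ k < j a, ω ∈ preferredTo θ arm reward n₀ b a k} ≤
      ENNReal.ofReal (4 * (|μ b - θ| ^ 2)⁻¹ * Real.exp (-κ)) := by
  have hH : 0 < ∑ a ∈ S, (|μ a - θ| ^ 2)⁻¹ :=
    Finset.sum_pos (fun a ha => gap_inv_pos (hS a ha).ne) hSne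
  refine (measure_excess_le P S (fun a k => preferredTo θ arm reward n₀ b a k)
    (fun a => 16 * (|μ b - θ| ^ 2)⁻¹ * Real.exp (-κ) * (|μ a - θ| ^ 2)⁻¹)
    (fun a => 4 * κ * (|μ a - θ| ^ 2)⁻¹) (fun a _ => by positivity) (fun a _ => by positivity)
    (by positivity) fun a ha => ?_).trans_eq ?_
  · have hd : 0 < (θ - μ a) ^ 2 := pow_pos (sub_pos.2 (hS a ha)) 2
    refine (tsum_overlap_mul_le (C := 4 * (|μ b - θ| ^ 2)⁻¹) (r := (θ - μ a) ^ 2 / 4)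
      (by positivity) (by positivity) (by positivity)
      (h.measure_preferredTo_le hν (hS a ha) hb hn₀)).trans_eq ?_
    have e : (θ - μ a) ^ 2 / 4 * (4 * κ * (|μ a - θ| ^ 2)⁻¹) = κ := by
      linear_combination κ * gap_inv_mul (hS a ha).ne
    rw [e, gap_inv_eq (x := μ a)]
    congr 1
    field_simp
    norm_num
  · rw [← Finset.mul_sum]
    generalize ∑ a ∈ S, (|μ a - θ| ^ 2)⁻¹ = T at hH ⊢
    congr 1
    field_simp
    norm_num

lemma IsBanditProcess.measure_excess_good_le (h : IsBanditProcess P ν ℱ arm reward)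
    (hν : ∀ a, IsOneSubGaussian (ν a) (μ a)) {S G : Finset (Fin K)} (hS : ∀ a ∈ S, μ a < θ)
    (hG : ∀ b ∈ G, θ < μ b) (hGne : G.Nonempty) {κ : ℝ} (hκ : 0 ≤ κ) :
    P {ω | ∃ j : Fin K → ℕ, 4 * ∑ b ∈ G, (|μ b - θ| ^ 2)⁻¹ +
        ∑ b ∈ G, 4 * κ * (|μ b - θ| ^ 2)⁻¹ < ∑ b ∈ G, (j b : ℝ) ∧
        ∀ b ∈ G, ∀ k < j b, ω ∈ dominatedBy θ arm reward S b k} ≤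
      ENNReal.ofReal (Real.exp (-(2 * κ)) / 2 +
        16 / 9 * (∑ a ∈ S, (|μ a - θ| ^ 2)⁻¹) * Real.exp (-(9 / 2 * κ)) +
        4 * (∑ a ∈ S, (|μ a - θ| ^ 2)⁻¹) * Real.exp (-κ)) := by
  have hH : 0 < ∑ b ∈ G, (|μ b - θ| ^ 2)⁻¹ :=
    Finset.sum_pos (fun b hb => gap_inv_pos (hG b hb).ne') hGne
  set Hb := ∑ a ∈ S, (|μ a - θ| ^ 2)⁻¹ with hHb
  have hHb0 : 0 ≤ Hb := Finset.sum_nonneg fun a _ => by positivity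
  refine (measure_excess_le P G (fun b k => dominatedBy θ arm reward S b k)
    (fun b => 4 * (Real.exp (-(2 * κ)) / 2 + 16 / 9 * Hb * Real.exp (-(9 / 2 * κ)) +
      4 * Hb * Real.exp (-κ)) * (|μ b - θ| ^ 2)⁻¹)
    (fun b => 4 * κ * (|μ b - θ| ^ 2)⁻¹) (fun b _ => by positivity) (fun b _ => by positivity)
    (by positivity) fun b hb => ?_).trans_eq ?_
  · have hd : 0 < (θ - μ b) ^ 2 := sq_pos_of_neg (sub_neg.2 (hG b hb))
    have hq : 0 ≤ 4 * κ * (|μ b - θ| ^ 2)⁻¹ := by positivity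
    have hg := gap_inv_mul (hG b hb).ne'
    have t1 := tsum_overlap_mul_le (C := 1) (r := (θ - μ b) ^ 2 / 2) zero_le_one
      (by positivity) hq fun k => le_rfl
    have t2 := tsum_overlap_mul_le (C := 8 * Hb) (r := 9 * (θ - μ b) ^ 2 / 8) (by positivity)
      (by positivity) hq fun k => le_rfl
    have t3 := tsum_overlap_mul_le (C := 4 * Hb) (r := (θ - μ b) ^ 2 / 4) (by positivity)
      (by positivity) hq fun k => le_rfl
    refine (ENNReal.tsum_le_tsum fun k =>
      mul_le_mul_right (h.measure_dominatedBy_le hν hS (hG b hb) k) _).trans ?_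
    simp only [mul_add (ENNReal.ofReal _), ← hHb]
    rw [ENNReal.tsum_add, ENNReal.tsum_add]
    refine (add_le_add t1 (add_le_add t2 t3)).trans_eq ?_
    rw [← ENNReal.ofReal_add (by positivity) (by positivity),
      ← ENNReal.ofReal_add (by positivity) (by positivity)]
    have e1 : (θ - μ b) ^ 2 / 2 * (4 * κ * (|μ b - θ| ^ 2)⁻¹) = 2 * κ := by
      linear_combination 2 * κ * hg
    have e2 : 9 * (θ - μ b) ^ 2 / 8 * (4 * κ * (|μ b - θ| ^ 2)⁻¹) = 9 / 2 * κ := by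
      linear_combination 9 / 2 * κ * hg
    have e3 : (θ - μ b) ^ 2 / 4 * (4 * κ * (|μ b - θ| ^ 2)⁻¹) = κ := by
      linear_combination κ * hg
    rw [e1, e2, e3, gap_inv_eq]
    congr 1
    field_simp
    ring
  · rw [← Finset.mul_sum]
    generalize ∑ b ∈ G, (|μ b - θ| ^ 2)⁻¹ = T at hH ⊢
    congr 1
    field_simp

/-- A wrong answer after `t` rounds forces a large excess of pulls in one of the two groups. -/
lemma FollowsAPGAI.excess_of_wrong {ω : Ω} (hn₀ : 0 < n₀)
    (hω : FollowsAPGAI n₀ θ (fun t => arm t ω) (fun t => reward t ω) (fun t => guess t ω))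
    {G S : Finset (Fin K)} (hGS : ∀ a, a ∉ G → a ∈ S) {b₀ : Fin K} {t : ℕ} (ht : n₀ * K ≤ t)
    (hwrong : ¬∃ a ∈ G, guess t ω = some a) :
    (∀ b, ∀ k < numPulls (fun t => arm t ω) b t - n₀, ω ∈ dominatedBy θ arm reward S b k) ∧
    ∀ a, ∀ k < numPulls (fun t => arm t ω) a t - n₀,
      ω ∈ preferredTo θ arm reward n₀ b₀ a k := by
  constructor
  · intro b k hk
    rcases hω.guess_spec hn₀ ht with ⟨-, hneg⟩ | ⟨hg, hpos⟩
    · refine Or.inl ⟨t, ?_, hneg b⟩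
      change _ ≤ numPulls _ _ _
      omega
    · have ha : arm (t + 1) ω ∈ S := hGS _ fun ha => hwrong ⟨_, ha, hg⟩
      have hN := hω.le_numPulls (arm (t + 1) ω) ht
      refine Or.inr (Set.mem_biUnion ha (Set.mem_iUnion.2
        ⟨numPulls (fun t => arm t ω) (arm (t + 1) ω) t - 1, t, ?_, ?_, hpos.le,
          hω.signedStat_le hn₀ ht b⟩))
      · change numPulls _ _ _ = _
        omega
      · change _ ≤ numPulls _ _ _
        omega
  · intro a k hk
    obtain ⟨s, -, hs0, hs, hsa⟩ := hω.exists_pull (a := a) (k := n₀ + k) (t := t)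
      (by omega) (by omega)
    have hN := hω.le_numPulls b₀ hs0
    have hle := hω.signedStat_le hn₀ hs0 b₀
    rw [hsa] at hle
    refine Set.mem_iUnion.2 ⟨numPulls (fun t => arm t ω) b₀ s - 1, s, hs, ?_, hle⟩
    change numPulls _ _ _ = _
    omega

theorem IsBanditProcess.good_answer (h : IsBanditProcess P ν ℱ arm reward)
    (hν : ∀ a, IsOneSubGaussian (ν a) (μ a)) (hμ : ∀ a, μ a ≠ θ) (hn₀ : 0 < n₀)
    (halg : ∀ᵐ ω ∂P, FollowsAPGAI n₀ θ (fun t => arm t ω) (fun t => reward t ω)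
      (fun t => guess t ω)) (hne : (goodArms θ μ).Nonempty) {δ : ℝ} (hδ : 0 < δ) (hδ1 : δ < 1) :
    ENNReal.ofReal (1 - δ) ≤ P {ω | ∀ t : ℕ,
      h₂ (Real.log (1 / δ)) (4 * H₁ θ μ) (n₀ * K + 2 * (goodArms θ μ).card) < t →
        ∃ a ∈ goodArms θ μ, guess t ω = some a} := by
  set G := goodArms θ μ with hGdef
  set S := Finset.univ.filter fun a => ¬θ ≤ μ a with hSdef
  have hG : ∀ b ∈ G, θ < μ b := fun b hb =>
    lt_of_le_of_ne (Finset.mem_filter.1 hb).2 (hμ b).symm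
  have hS : ∀ a ∈ S, μ a < θ := fun a ha => not_le.1 (Finset.mem_filter.1 ha).2
  have hGS : ∀ a, a ∉ G → a ∈ S := fun a ha =>
    Finset.mem_filter.2 ⟨Finset.mem_univ a, fun h' =>
      ha (Finset.mem_filter.2 ⟨Finset.mem_univ a, h'⟩)⟩
  have hsum : ∀ f : Fin K → ℝ, ∑ a ∈ G, f a + ∑ a ∈ S, f a = ∑ a, f a := fun f =>
    Finset.sum_filter_add_sum_filter_not _ _ f
  obtain ⟨b₀, hb₀⟩ := hne
  have hcard : (1 : ℝ) ≤ G.card := by exact_mod_cast Finset.card_pos.2 ⟨b₀, hb₀⟩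
  have hnB : (1 : ℝ) ≤ n₀ := by exact_mod_cast hn₀
  have hKn : (K : ℝ) ≤ n₀ * K := le_mul_of_one_le_left (by positivity) hnB
  have hK1 : (1 : ℝ) ≤ K := by exact_mod_cast (Fin.pos b₀ : 0 < K)
  set Hg := ∑ b ∈ G, (|μ b - θ| ^ 2)⁻¹ with hHg
  set Hb := ∑ a ∈ S, (|μ a - θ| ^ 2)⁻¹ with hHb
  have hH : H₁ θ μ = Hg + Hb := (hsum fun a => (|μ a - θ| ^ 2)⁻¹).symm
  have hHb0 : 0 ≤ Hb := Finset.sum_nonneg fun a _ => by positivity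
  have hbg : (|μ b₀ - θ| ^ 2)⁻¹ ≤ Hg :=
    Finset.single_le_sum (f := fun b => (|μ b - θ| ^ 2)⁻¹) (fun b _ => by positivity) hb₀
  have hb0 : 0 < (|μ b₀ - θ| ^ 2)⁻¹ := gap_inv_pos (hμ b₀)
  rw [hH]
  obtain ⟨c, hc0, hU, -, hUδ⟩ := h₂_spec (A := 4 * (Hg + Hb))
    (B := n₀ * K + 2 * G.card) (by linarith) (by linarith) hδ hδ1
  set U := h₂ (Real.log (1 / δ)) (4 * (Hg + Hb)) (n₀ * K + 2 * G.card)
  have hHc : 0 ≤ 4 * (Hg + Hb) * c := mul_nonneg (by linarith) hc0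
  have hU3 : 3 ≤ U := by linarith
  have hUc : U ≤ Real.exp c := by
    have h1 : U * Real.exp (-c) ≤ 1 := by linarith
    rwa [Real.exp_neg, ← div_eq_mul_inv, div_le_one (Real.exp_pos c)] at h1
  -- The budget 4cH of a group splits into cutoffs 4κH and excess 4(c − κ)H; κ = c − 1 minimizes
  -- e^{-κ}/(c − κ).
  have hκ : 0 ≤ c - 1 := sub_nonneg.2 (one_le_of_three_le_exp (hU3.trans hUc))
  have hg := h.measure_excess_good_le hν hS hG ⟨b₀, hb₀⟩ hκ
  rw [← hHg, ← hHb] at hg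
  set B₁ : Set Ω := {ω | ∃ j : Fin K → ℕ, 4 * Hg +
    ∑ b ∈ G, 4 * (c - 1) * (|μ b - θ| ^ 2)⁻¹ < ∑ b ∈ G, (j b : ℝ) ∧
    ∀ b ∈ G, ∀ k < j b, ω ∈ dominatedBy θ arm reward S b k} with hB₁
  set B₂ : Set Ω := {ω | ∃ j : Fin K → ℕ, 4 * Hb +
    ∑ a ∈ S, 4 * (c - 1) * (|μ a - θ| ^ 2)⁻¹ < ∑ a ∈ S, (j a : ℝ) ∧
    ∀ a ∈ S, ∀ k < j a, ω ∈ preferredTo θ arm reward n₀ b₀ a k} with hB₂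
  refine ofReal_one_sub_le (B := B₁ ∪ B₂) hδ.le ?_ ?_
  · refine (measure_union_le _ _).trans ?_
    rcases S.eq_empty_or_nonempty with hSe | hSne
    · have h1 : B₂ = ∅ := by
        rw [hB₂, hHb, hSe]
        simp
      rw [h1, measure_empty, add_zero]
      refine hg.trans (ENNReal.ofReal_le_ofReal ?_)
      have h2 : Hb = 0 := by rw [hHb, hSe, Finset.sum_empty]
      rw [h2, ← hUδ]
      have := half_exp_neg_le hU3 hUc
      linarith
    · have hb := h.measure_excess_bad_le hν hS hSne (hG b₀ hb₀) hn₀ hκ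
      refine (add_le_add hg hb).trans ?_
      rw [← ENNReal.ofReal_add (by positivity) (by positivity), ← hUδ]
      refine ENNReal.ofReal_le_ofReal (total_error_le hHb0 hb0.le hbg ?_ hUc hc0)
      -- With both groups nonempty, n₀K + 2|G| ≥ 4, the constant that `total_error_le` needs.
      have hK2 : (2 : ℝ) ≤ K := by
        obtain ⟨a, ha⟩ := hSne
        have hab : a ≠ b₀ := fun e => (hS a ha).not_gt (e ▸ hG b₀ hb₀)
        have : 2 ≤ Fintype.card (Fin K) := Fintype.one_lt_card_iff.2 ⟨a, b₀, hab⟩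
        rw [Fintype.card_fin] at this
        exact_mod_cast this
      linarith
  · filter_upwards [halg] with ω hω hB t ht
    have ht0 : n₀ * K ≤ t := by exact_mod_cast (show (n₀ * K : ℝ) ≤ t by linarith)
    by_contra hwrong
    obtain ⟨hd, hp⟩ := hω.excess_of_wrong hn₀ hGS (b₀ := b₀) ht0 hwrong
    set j : Fin K → ℕ := fun a => numPulls (fun t => arm t ω) a t - n₀
    have hj : ∑ a, (j a : ℝ) = t - n₀ * K := by
      have e : ∀ a, (j a : ℝ) = numPulls (fun t => arm t ω) a t - n₀ := fun a =>
        Nat.cast_sub (hω.le_numPulls a ht0)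
      simp only [e]
      rw [Finset.sum_sub_distrib, sum_numPulls_cast, Finset.sum_const, Finset.card_univ,
        Fintype.card_fin, nsmul_eq_mul, mul_comm]
    rw [← hsum] at hj
    refine hB ?_
    -- The extra pulls total t − n₀K > 4c(Hg + Hb), so one group exceeds its share.
    rcases lt_or_ge (4 * c * Hg) (∑ a ∈ G, (j a : ℝ)) with h1 | h1
    · refine Or.inl ⟨j, ?_, fun b _ => hd b⟩
      rw [← Finset.mul_sum]
      linarith
    · refine Or.inr ⟨j, ?_, fun a _ => hp a⟩
      rw [← Finset.mul_sum]
      linarith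

end GoodArmExists

end GoodArm

end

theorem mainTheorem4 {Ω : Type*} {mΩ : MeasurableSpace Ω} (P : Measure Ω) [IsProbabilityMeasure P]
    (K : ℕ) (hK : 0 < K) (n₀ : ℕ) (hn₀ : 0 < n₀) (θ : ℝ)
    (ν : Fin K → Measure ℝ) (μ : Fin K → ℝ)
    (hν : ∀ a, GoodArm.IsOneSubGaussian (ν a) (μ a)) (hμ : ∀ a, μ a ≠ θ)
    (ℱ : Filtration ℕ mΩ) (arm : ℕ → Ω → Fin K) (reward : ℕ → Ω → ℝ)
    (guess : ℕ → Ω → Option (Fin K))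
    (hbandit : GoodArm.IsBanditProcess P ν ℱ arm reward)
    (halg : ∀ᵐ ω ∂P, GoodArm.FollowsAPGAI n₀ θ (fun t => arm t ω) (fun t => reward t ω)
      (fun t => guess t ω)) :
    (∀ δ : ℝ, 0 < δ → δ < 1 →
      (GoodArm.goodArms θ μ = ∅ →
        ENNReal.ofReal (1 - δ) ≤
          P {ω | ∀ t : ℕ, GoodArm.unverifiableTime n₀ θ μ δ < t → guess t ω = none}) ∧
      (GoodArm.goodArms θ μ ≠ ∅ →
        ENNReal.ofReal (1 - δ) ≤
          P {ω | ∀ t : ℕ, GoodArm.unverifiableTime n₀ θ μ δ < t →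
            ∃ a ∈ GoodArm.goodArms θ μ, guess t ω = some a})) ∧
    (∀ A B : ℝ, 0 < A →
      (fun δ : ℝ => GoodArm.h₂ (Real.log (1 / δ)) A B - A * Real.log (1 / δ))
        =O[𝓝[>] 0] fun δ : ℝ => Real.log (Real.log (1 / δ))) ∧
    (fun δ : ℝ => GoodArm.unverifiableTime n₀ θ μ δ -
        (if GoodArm.goodArms θ μ = ∅ then 18 else 4) * GoodArm.H₁ θ μ * Real.log (1 / δ))
      =O[𝓝[>] 0] fun δ : ℝ => Real.log (Real.log (1 / δ)) := by
  have hH : 0 < GoodArm.H₁ θ μ :=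
    Finset.sum_pos (fun a _ => GoodArm.gap_inv_pos (hμ a)) ⟨⟨0, hK⟩, Finset.mem_univ _⟩
  refine ⟨fun δ hδ hδ1 => ⟨fun he => ?_, fun hne => ?_⟩, fun A B hA => GoodArm.h₂_isBigO B hA, ?_⟩
  · simp only [GoodArm.unverifiableTime, if_pos he]
    have hμ' : ∀ a, μ a < θ := fun a => by
      by_contra! hle
      have : a ∈ GoodArm.goodArms θ μ := Finset.mem_filter.2 ⟨Finset.mem_univ a, hle⟩
      simp [he] at this
    rcases (Nat.succ_le_of_lt hK).eq_or_lt with h1 | h1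
    · subst h1
      exact hbandit.empty_of_one hν hμ' hn₀ halg hδ hδ1
    · exact hbandit.empty_of_one_lt hν hμ' h1 hn₀ halg hδ hδ1
  · simp only [GoodArm.unverifiableTime, if_neg hne]
    exact hbandit.good_answer hν hμ hn₀ halg (Finset.nonempty_iff_ne_empty.2 hne) hδ hδ1
  · by_cases he : GoodArm.goodArms θ μ = ∅
    · simp only [GoodArm.unverifiableTime, if_pos he]
      exact GoodArm.h₂_isBigO _ (by positivity)
    · simp only [GoodArm.unverifiableTime, if_neg he]
      exact GoodArm.h₂_isBigO _ (by positivity)
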